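/- Consider either the white noise model $dY(t)=f(t)\,dt+n^{-1/2}dW(t)$, $-\tfrac12\le t\le\tfrac12$, where $W$ is standard Brownian motion and the functions $f$ are square integrable, or the sequence model $Y(i)=f(i)+n^{-1/2}z_i$, $i\in\mathcal M$, where the $z_i$ are i.i.d. standard normal, $\mathcal M$ is finite or countably infinite and the sequences $f$ are square summable; here $n>0$. Let $P_f$ and $E_f$ denote the law of the data and the expectation under $f$, and let $\|\cdot\|_2$ be the $L_2(-\tfrac12,\tfrac12)$ norm, respectively the $\ell_2(\mathcal M)$ norm. Let $T$ be a linear functional on a linear space $V$ of such $f$; no continuity of $T$ is assumed. Write $z_\beta=\Phi^{-1}(1-\beta)$, where $\Phi$ is the standard normal distribution function. For a random interval $CI$ (a measurable function of the data, possibly empty or unbounded) with length $L(CI)$ and for a set $\mathcal F\subseteq V$ put $L(CI,\mathcal F)=\sup_{f\in\mathcal F}E_fL(CI)\in[0,\infty]$. Let $\mathcal I_{\alpha,\mathcal F}$ be the set of random intervals with $P_f(Tf\in CI)\ge 1-\alpha$ for all $f\in\mathcal F$, let $L^*_\alpha(\mathcal F,\mathcal G)=\inf_{CI\in\mathcal I_{\alpha,\mathcal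 G}}L(CI,\mathcal F)$, and let $\omega(\varepsilon,\mathcal F,\mathcal G)=\sup\{Tg-Tf:\ \|g-f\|_2\le\varepsilon,\ f\in\mathcal F,\ g\in\mathcal G\}\in[-\infty,\infty]$. Let $0<\alpha<\tfrac12$, $k\ge1$, and let $\mathcal F_1,\dots,\mathcal F_k\subseteq V$ be convex with $\mathcal F_i\cap\mathcal F_j\ne\emptyset$ for all $i,j$; put $\mathcal G=\bigcup_{j=1}^k\mathcal F_j$ and $\omega_{i,j}=\omega\big(z_{\alpha/2k}/\sqrt n,\mathcal F_i,\mathcal F_j\big)\in[0,\infty]$. Call a family $(\hat T_{i,j})_{1\le i,j\le k}$ admissible if each $\hat T_{i,j}$ is a linear estimator (that is, $\hat T_{i,j}=c+\int u\,dY$, respectively $c+\sum_i u_iY(i)$, with $c\in\mathbb R$ and $u$ square integrable, respectively square summable) such that $$\operatorname{Var}(\hat T_{i,j})\le\frac{\omega_{i,j}^2}{z_{\alpha/2k}^2},\qquad \inf_{f\in\mathcal F_j}\big(E_f\hat T_{i,j}-Tf\big)\ge-\tfrac12\omega_{i,j},\qquad \sup_{f\in\mathcal F_i}\big(E_f\hat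 T_{i,j}-Tf\big)\le\tfrac12\omega_{i,j}.$$ Then admissible families exist, and for every admissible family the interval $$CI^*=\bigcap_{j=1}^k CI^*_{j,\alpha/k},\qquad CI^*_{j,\alpha/k}=\Big[\min_i\{\hat T_{i,j}-\tfrac32\omega_{i,j}\},\ \max_i\{\hat T_{j,i}+\tfrac32\omega_{j,i}\}\Big],$$ belongs to $\mathcal I_{\alpha,\mathcal G}$ and satisfies, for all $1\le j\le k$, $$L^*_\alpha(\mathcal F_j,\mathcal G)\ \le\ L(CI^*,\mathcal F_j)\ \le\ \frac{12\,z_{\alpha/2k}}{(1/2-\alpha)\,z_\alpha}\,L^*_\alpha(\mathcal F_j,\mathcal G).$$ Moreover $z_{\alpha/2k}\le\sqrt{\tfrac{2}{z_{\alpha/2}^2}\log k+1}\;z_{\alpha/2}$, so that this factor grows at most like $\sqrt{\log k}$ in $k$. -/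

import Mathlib

open MeasureTheory ProbabilityTheory Filter Topology
open scoped ENNReal NNReal

noncomputable section

/-- The upper quantile `z_α = Φ⁻¹(1 - α)` of the standard normal distribution. -/
def zQuantile (α : ℝ) : ℝ :=
  sInf {x : ℝ | 1 - α ≤ cdf (gaussianReal 0 1) x}

/-! ### The two Gaussian models -/

/-- The time interval `[-1/2, 1/2]`. -/
abbrev TimeInterval : Type := Set.Icc (-(1 / 2) : ℝ) (1 / 2)

/-- Lebesgue measure on `[-1/2, 1/2]`. -/
def lebesgue : Measure TimeInterval := Measure.comap Subtype.val volume

/-- The two Gaussian models: the white noise model on `[-1/2, 1/2]`, and the sequence model over a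
finite or countably infinite index set `M`. -/
inductive GaussianModel : Type 1
  | whiteNoise : GaussianModel
  | sequence (M : Type) (hM : Countable M) : GaussianModel

namespace GaussianModel

/-- The set on which both the unknown function `f` and the observed data `Y` are indexed. -/
def Index : GaussianModel → Type
  | whiteNoise => TimeInterval
  | sequence M _ => M

/-- Square integrable functions on `[-1/2, 1/2]`, respectively square summable sequences. -/
def SquareIntegrable : (𝓜 : GaussianModel) → (𝓜.Index → ℝ) → Prop
  | whiteNoise => fun (f : TimeInterval → ℝ) => MemLp f 2 lebesgue
  | sequence M _ => fun (f : M → ℝ) => Summable fun i => f i ^ 2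

/-- The `L²(-1/2, 1/2)` function norm, respectively the `ℓ²(M)` sequence norm. -/
def l2Norm : (𝓜 : GaussianModel) → (𝓜.Index → ℝ) → ℝ
  | whiteNoise => fun (f : TimeInterval → ℝ) => √(∫ t, f t ^ 2 ∂lebesgue)
  | sequence M _ => fun (f : M → ℝ) => √(∑' i, f i ^ 2)

/-- The noiseless observation: the path `t ↦ ∫_{-1/2}^t f(s) ds` in the white noise model, the
sequence `f` itself in the sequence model. -/
def signal : (𝓜 : GaussianModel) → (𝓜.Index → ℝ) → 𝓜.Index → ℝ
  | whiteNoise => fun (f : TimeInterval → ℝ)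
      (t : TimeInterval) => ∫ s in Set.Iic t, f s ∂lebesgue
  | sequence M _ => fun (f : M → ℝ) => f

/-- The noise: a standard Brownian motion started at time `-1/2` in the white noise model, i.i.d.
standard normal variables in the sequence model. -/
def IsNoise {Ω : Type*} [MeasurableSpace Ω] (μ : Measure Ω) :
    (𝓜 : GaussianModel) → (𝓜.Index → Ω → ℝ) → Prop
  | whiteNoise => fun (Z : TimeInterval → Ω → ℝ) =>
      (∀ t, Measurable (Z t)) ∧
        ∃ W : ℝ≥0 → Ω → ℝ, IsBrownianReal W μ ∧ ∀ t, Z t = W (Real.toNNReal ((t : ℝ) + 1 / 2))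
  | sequence M _ => fun (Z : M → Ω → ℝ) =>
      (∀ i, Measurable (Z i)) ∧ iIndepFun Z μ ∧ ∀ i, HasLaw (Z i) (gaussianReal 0 1) μ

/-- The law `P_f` of the data: `Y(t) = ∫_{-1/2}^t f(s) ds + n^{-1/2} W(t)` in the white noise
model, `Y(i) = f(i) + n^{-1/2} z_i` in the sequence model. -/
def law {Ω : Type*} [MeasurableSpace Ω] (𝓜 : GaussianModel) (μ : Measure Ω)
    (Z : 𝓜.Index → Ω → ℝ) (n : ℝ) (f : 𝓜.Index → ℝ) : Measure (𝓜.Index → ℝ) :=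
  μ.map fun ω t => 𝓜.signal f t + (√n)⁻¹ * Z t ω

end GaussianModel

/-! ### Confidence intervals and their expected length

Here `P` is any family of laws of the data `y : X`, indexed by the parameter `f : Θ`, and
`T : Θ → ℝ` is the functional of interest. -/

section ConfidenceIntervals

variable {Θ X : Type*} [MeasurableSpace X]

/-- A data-dependent interval `[lo, hi]` with measurable endpoints. The endpoints may be infinite,
and the interval is empty when `hi < lo`. -/
def IsRandomInterval (C : X → Set ℝ) : Prop :=
  ∃ lo hi : X → EReal, Measurable lo ∧ Measurable hi ∧
    ∀ y, C y = {x : ℝ | lo y ≤ (x : EReal) ∧ (x : EReal) ≤ hi y}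

/-- `𝓘_{α, G}`: the intervals which cover `T f` with probability at least `1 - α` for all
`f ∈ G`. -/
def confidenceIntervals (P : Θ → Measure X) (T : Θ → ℝ) (α : ℝ) (G : Set Θ) :
    Set (X → Set ℝ) :=
  {C | IsRandomInterval C ∧ ∀ f ∈ G, ENNReal.ofReal (1 - α) ≤ P f {y | T f ∈ C y}}

/-- `L(C, F) = sup_{f ∈ F} E_f(L(C))`, the maximum expected length of `C` over `F`. -/
def maxExpectedLength (P : Θ → Measure X) (C : X → Set ℝ) (F : Set Θ) : ℝ≥0∞ :=
  ⨆ f ∈ F, ∫⁻ y, volume (C y) ∂(P f)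

/-- `L*_α(F, G)`, the infimum of `L(C, F)` over `C ∈ 𝓘_{α, G}`. -/
def optimalLength (P : Θ → Measure X) (T : Θ → ℝ) (α : ℝ) (F G : Set Θ) : ℝ≥0∞ :=
  ⨅ C ∈ confidenceIntervals P T α G, maxExpectedLength P C F

end ConfidenceIntervals

/-! ### Modulus of continuity, linear estimators, and the intervals built from them

`V` is a linear space of functions (respectively sequences) on which the linear functional `T` is
defined. -/

namespace GaussianModel

variable {Ω : Type*} [MeasurableSpace Ω] (𝓜 : GaussianModel)
  {V : Submodule ℝ (𝓜.Index → ℝ)}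

/-- The ordered modulus of continuity
`ω(ε, F, G) = sup {T g - T f : ‖g - f‖₂ ≤ ε, f ∈ F, g ∈ G}`. -/
def orderedModulus (T : V →ₗ[ℝ] ℝ) (ε : ℝ) (F G : Set V) : EReal :=
  ⨆ (f ∈ F) (g ∈ G) (_ : 𝓜.l2Norm ((g - f : V) : 𝓜.Index → ℝ) ≤ ε), ((T g - T f : ℝ) : EReal)

/-- A linear (more precisely affine) estimator `c + ∫ u dY`, respectively `c + ∑ u_i Y(i)`, with
`u` square integrable: a measurable function of the data which, under every `P_f`, is the
mean-square limit of the finite linear combinations `c + ∑_t a_m(t) Y(t)`, for one and the same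
constant `c` and sequence of finitely supported coefficients `a_m`. -/
def IsLinearEstimator (P : V → Measure (𝓜.Index → ℝ)) (S : (𝓜.Index → ℝ) → ℝ) : Prop :=
  Measurable S ∧ ∃ (c : ℝ) (a : ℕ → 𝓜.Index →₀ ℝ), ∀ f : V,
    Tendsto (fun m => eLpNorm (fun y => S y - (c + (a m).sum fun t r => r * y t)) 2 (P f))
      atTop (𝓝 0)

/-- The requirements on the estimators `S i j` at level `1 - β`, where
`ω i j = ω(z_{β/2} / √n, F i, F j)`: the variance of `S i j` is at most `(ω i j)² / z_{β/2}²`, its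
bias over `F j` is at least `-(1/2) ω i j` and its bias over `F i` is at most `(1/2) ω i j`. -/
structure IsEstimatorFamily {k : ℕ} (P : V → Measure (𝓜.Index → ℝ)) (n : ℝ) (T : V →ₗ[ℝ] ℝ)
    (F : Fin k → Set V) (β : ℝ) (S : Fin k → Fin k → (𝓜.Index → ℝ) → ℝ) : Prop where
  linear : ∀ i j, 𝓜.IsLinearEstimator P (S i j)
  variance_le : ∀ i j, ∀ f : V, ((Var[S i j; P f] : ℝ) : EReal) ≤
    ((1 / zQuantile (β / 2) ^ 2 : ℝ) : EReal) *
      𝓜.orderedModulus T (zQuantile (β / 2) / √n) (F i) (F j) ^ 2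
  le_bias : ∀ i j, ∀ f ∈ F j,
    -(((1 / 2 : ℝ) : EReal) * 𝓜.orderedModulus T (zQuantile (β / 2) / √n) (F i) (F j)) ≤
      ((∫ y, S i j y ∂(P f) - T f : ℝ) : EReal)
  bias_le : ∀ i j, ∀ f ∈ F i,
    ((∫ y, S i j y ∂(P f) - T f : ℝ) : EReal) ≤
      ((1 / 2 : ℝ) : EReal) * 𝓜.orderedModulus T (zQuantile (β / 2) / √n) (F i) (F j)

/-- `CI*_{j, β} = [min_i {S i j - (3/2) ω i j}, max_i {S j i + (3/2) ω j i}]`, where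
`ω i j = ω(z_{β/2} / √n, F i, F j)`. -/
def starInterval {k : ℕ} (n : ℝ) (T : V →ₗ[ℝ] ℝ) (F : Fin k → Set V) (β : ℝ)
    (S : Fin k → Fin k → (𝓜.Index → ℝ) → ℝ) (j : Fin k) (y : 𝓜.Index → ℝ) : Set ℝ :=
  {x : ℝ |
    ⨅ i, ((S i j y : EReal) - ((3 / 2 : ℝ) : EReal) *
      𝓜.orderedModulus T (zQuantile (β / 2) / √n) (F i) (F j)) ≤ (x : EReal) ∧
    (x : EReal) ≤ ⨆ i, ((S j i y : EReal) + ((3 / 2 : ℝ) : EReal) *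
      𝓜.orderedModulus T (zQuantile (β / 2) / √n) (F j) (F i))}

/-- The Bonferroni interval `CI* = ⋂_j CI*_{j, α/k}`. -/
def bonferroniInterval {k : ℕ} (n : ℝ) (T : V →ₗ[ℝ] ℝ) (F : Fin k → Set V) (α : ℝ)
    (S : Fin k → Fin k → (𝓜.Index → ℝ) → ℝ) (y : 𝓜.Index → ℝ) : Set ℝ :=
  ⋂ j, 𝓜.starInterval n T F (α / k) S j y

end GaussianModel

end

/-!
The noise level is absorbed into the geometry: both models are Gaussian shift experiments, in which
the data have mean `t ↦ ⟪e t, θ⟫` and covariance `⟪e s, e t⟫` for vectors `e t` spanning a dense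
subspace of a Hilbert space, with the shift `θ = ι f = √n f` (`exists_isShiftRepresentation`).
Everything else is proved for such experiments.

*Existence.* Let `w` be the modulus at `z = z_{α / 2k}` for the pair `(F i, F j)`. As the two
convex sets meet, `T g - T f ≤ w + (w / z) ‖ι g - ι f‖` for all `f ∈ F i` and `g ∈ F j`. The right
side is a continuous convex function on the Hilbert space, so Hahn–Banach separation puts a
continuous affine function of slope at most `w / z` in between (`exists_inner_sandwich`), although
`T` itself need not be continuous. Its Wiener integral is the required estimator.

*Coverage.* Linear estimators are Gaussian under every law of the data
(`hasLaw_of_isLinearEstimator`), so each of the `2 k` endpoints that matter for a given `f` fails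
with probability at most `α / 2k`.

*Lower bound.* If `f, g ∈ ⋃ F i` are within `z_α` standard deviations of each other, an interval
with coverage `1 - α` covers `T g` with probability at least `1 / 2` under `f`, by the
Cameron–Martin density and the Neyman–Pearson comparison (`IsGaussianShift.half_le_of_le`). It
therefore covers `T f` and `T g` at once with probability at least `1 / 2 - α`. Shrinking pairs
towards a common point of `F i` and `F j` replaces the modulus at `z_α` by `z_α / z` times the
modulus at `z`, so all moduli involving `F j` are at most `M = z L* / ((1 / 2 - α) z_α)`.

*Upper bound.* Over `F j` either endpoint is within `2 M` of `T f` up to the largest of `k` normal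
variables with standard deviations at most `M / z`. The expectation of the positive part of that
maximum is at most `M + k (M / z) E (N - z)⁺ ≤ M + k (M / z) (α / 2k) / z`, which is at most `2 M`
because `z ≥ 1 / 2`. The expected length is thus at most `8 M ≤ 12 M`.

The growth of `z_{α / 2k}` in `k` follows from `P (N > z + δ) ≤ exp (-z δ - δ² / 2) P (N > z)`.
-/

/-! ### Normal tails and quantiles -/

/-- The standard normal density is at most `1/2`. -/
lemma gaussianPDF_std_le (x : ℝ) : gaussianPDF 0 1 x ≤ ENNReal.ofReal (1 / 2) := by
  refine ENNReal.ofReal_le_ofReal ?_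
  rw [gaussianPDFReal]
  have h1 : Real.exp (-(x - 0) ^ 2 / (2 * ((1 : ℝ≥0) : ℝ))) ≤ 1 := by
    rw [Real.exp_le_one_iff]
    have := sq_nonneg (x - 0)
    simp only [NNReal.coe_one]
    linarith
  have h2 : (2 : ℝ) ≤ √(2 * Real.pi * ((1 : ℝ≥0) : ℝ)) := by
    apply Real.le_sqrt_of_sq_le
    have := Real.pi_gt_three
    simp only [NNReal.coe_one]
    linarith
  calc _ ≤ (√(2 * Real.pi * ((1 : ℝ≥0) : ℝ)))⁻¹ * 1 := by gcongr
    _ ≤ 1 / 2 := by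
      rw [mul_one, one_div]
      gcongr

lemma cdf_gaussian_sub_le {a b : ℝ} (hab : a ≤ b) :
    cdf (gaussianReal 0 1) b - cdf (gaussianReal 0 1) a ≤ (b - a) / 2 := by
  have h : gaussianReal 0 1 (Set.Ioc a b) ≤ ENNReal.ofReal ((b - a) / 2) := by
    rw [gaussianReal_apply 0 one_ne_zero]
    calc _ ≤ ∫⁻ _ in Set.Ioc a b, ENNReal.ofReal (1 / 2) :=
          lintegral_mono fun x => gaussianPDF_std_le x
      _ = _ := by
        rw [setLIntegral_const, Real.volume_Ioc, ← ENNReal.ofReal_mul (by norm_num)]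
        congr 1
        ring
  rw [cdf_eq_real, cdf_eq_real, ← measureReal_sdiff (Set.Iic_subset_Iic.2 hab) measurableSet_Iic,
    Set.Iic_sdiff_Iic, measureReal_def]
  exact ENNReal.toReal_le_of_le_ofReal (by linarith) h

lemma continuous_cdf_gaussian : Continuous fun x => cdf (gaussianReal 0 1) x := by
  refine (LipschitzWith.of_le_add_mul (1 / 2) fun x y => ?_).continuous
  rcases le_total y x with h | h
  · have := cdf_gaussian_sub_le h
    rw [Real.dist_eq, abs_of_nonneg (by linarith)]
    push_cast
    linarith
  · have := monotone_cdf (gaussianReal 0 1) h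
    have : 0 ≤ dist x y := dist_nonneg
    push_cast
    linarith

lemma bddBelow_quantile_set {α : ℝ} (hα : α < 1) :
    BddBelow {x : ℝ | 1 - α ≤ cdf (gaussianReal 0 1) x} := by
  obtain ⟨b, hb⟩ := ((tendsto_cdf_atBot (gaussianReal 0 1)).eventually_lt_const
    (show (0 : ℝ) < 1 - α by linarith)).exists
  refine ⟨b, ?_⟩
  intro x hx
  rw [Set.mem_ofPred_eq] at hx
  by_contra! hxb
  have := monotone_cdf (gaussianReal 0 1) hxb.le
  linarith

lemma zQuantile_le {α x : ℝ} (hα : α < 1) (h : 1 - α ≤ cdf (gaussianReal 0 1) x) :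
    zQuantile α ≤ x :=
  csInf_le (bddBelow_quantile_set hα) h

lemma cdf_zQuantile {α : ℝ} (h0 : 0 < α) (h1 : α < 1) :
    cdf (gaussianReal 0 1) (zQuantile α) = 1 - α := by
  obtain ⟨a, ha⟩ := ((tendsto_cdf_atBot (gaussianReal 0 1)).eventually_lt_const
    (show (0 : ℝ) < 1 - α by linarith)).exists
  obtain ⟨b, hb⟩ := ((tendsto_cdf_atTop (gaussianReal 0 1)).eventually_const_lt
    (show 1 - α < 1 by linarith)).exists
  obtain ⟨x, hx⟩ := mem_range_of_exists_le_of_exists_ge continuous_cdf_gaussian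
    ⟨a, ha.le⟩ ⟨b, hb.le⟩
  refine le_antisymm ?_ ?_
  · rw [← hx]
    exact monotone_cdf _ (zQuantile_le h1 hx.ge)
  · exact (isClosed_Ici.preimage continuous_cdf_gaussian).csInf_mem ⟨x, hx.ge⟩
      (bddBelow_quantile_set h1)

lemma zQuantile_anti {α β : ℝ} (h0 : 0 < α) (hαβ : α ≤ β) (h1 : β < 1) :
    zQuantile β ≤ zQuantile α := by
  apply zQuantile_le h1
  rw [cdf_zQuantile h0 (hαβ.trans_lt h1)]
  linarith

lemma gaussianReal_Ioi (x : ℝ) :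
    gaussianReal 0 1 (Set.Ioi x) = ENNReal.ofReal (1 - cdf (gaussianReal 0 1) x) := by
  rw [← Set.compl_Iic, prob_compl_eq_one_sub measurableSet_Iic, ← ofReal_cdf,
    ENNReal.ofReal_sub _ (cdf_nonneg _ _), ENNReal.ofReal_one]

lemma gaussianReal_Ioi_zQuantile {α : ℝ} (h0 : 0 < α) (h1 : α < 1) :
    gaussianReal 0 1 (Set.Ioi (zQuantile α)) = ENNReal.ofReal α := by
  rw [gaussianReal_Ioi, cdf_zQuantile h0 h1, sub_sub_cancel]

/-- Symmetry of the normal law about its mean. -/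
lemma cdf_gaussian_neg (x : ℝ) :
    cdf (gaussianReal 0 1) (-x) = 1 - cdf (gaussianReal 0 1) x := by
  have h : gaussianReal 0 1 (Set.Iic (-x)) = gaussianReal 0 1 (Set.Ioi x) := by
    have : NullSingletonClass (gaussianReal 0 1) := nullSingletonClass_gaussianReal one_ne_zero
    have h1 := gaussianReal_map_neg (μ := 0) (v := 1)
    rw [neg_zero] at h1
    conv_lhs => rw [← h1]
    rw [Measure.map_apply measurable_neg measurableSet_Iic]
    have : (fun x : ℝ => -x) ⁻¹' Set.Iic (-x) = Set.Ici x := by ext; simp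
    rw [this]
    exact measure_congr Ioi_ae_eq_Ici.symm
  rw [← ofReal_cdf, gaussianReal_Ioi] at h
  rwa [ENNReal.ofReal_eq_ofReal_iff (cdf_nonneg _ _)
    (by linarith [cdf_le_one (gaussianReal 0 1) x])] at h

lemma cdf_gaussian_zero : cdf (gaussianReal 0 1) 0 = 1 / 2 := by
  have := cdf_gaussian_neg 0
  rw [neg_zero] at this
  linarith

lemma zQuantile_pos {α : ℝ} (h0 : 0 < α) (h1 : α < 1 / 2) : 0 < zQuantile α := by
  by_contra! h
  have h2 := monotone_cdf (gaussianReal 0 1) h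
  rw [cdf_zQuantile h0 (by linarith), cdf_gaussian_zero] at h2
  linarith

lemma half_le_zQuantile {α : ℝ} (h0 : 0 < α) (h1 : α ≤ 1 / 4) : 1 / 2 ≤ zQuantile α := by
  have h2 := cdf_gaussian_sub_le (zQuantile_pos h0 (by linarith)).le
  rw [cdf_zQuantile h0 (by linarith), cdf_gaussian_zero] at h2
  linarith

/-- Translating the tail: `φ (x + δ) ≤ exp (-(z δ + δ² / 2)) φ x` for `x ≥ z`. -/
lemma gaussianReal_Ioi_add_le {z δ : ℝ} (hδ : 0 ≤ δ) :
    gaussianReal 0 1 (Set.Ioi (z + δ)) ≤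
      ENNReal.ofReal (Real.exp (-(z * δ + δ ^ 2 / 2))) * gaussianReal 0 1 (Set.Ioi z) := by
  rw [gaussianReal_apply 0 one_ne_zero, gaussianReal_apply 0 one_ne_zero,
    ← lintegral_const_mul _ (measurable_gaussianPDF 0 1)]
  have h := (measurePreserving_add_right (volume : Measure ℝ) δ).setLIntegral_comp_preimage
    (measurableSet_Ioi (a := z + δ)) (measurable_gaussianPDF 0 1)
  have hp : (fun x : ℝ => x + δ) ⁻¹' Set.Ioi (z + δ) = Set.Ioi z := by ext; simp
  rw [hp] at h
  rw [← h]
  refine setLIntegral_mono' measurableSet_Ioi fun x (hx : z < x) => ?_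
  rw [gaussianPDF, gaussianPDF, ← ENNReal.ofReal_mul (Real.exp_nonneg _)]
  refine ENNReal.ofReal_le_ofReal ?_
  rw [gaussianPDFReal, gaussianPDFReal, mul_left_comm, ← Real.exp_add]
  gcongr
  simp only [NNReal.coe_one, sub_zero]
  nlinarith [mul_le_mul_of_nonneg_right hx.le hδ]

/-- `E (N - z)⁺ ≤ P (N > z) / z` for a standard normal `N`: the tail at `z + t` is at most
`exp (-z t)` times the tail at `z`, and the left side is the integral of the tails over `t > 0`. -/
lemma lintegral_gaussian_excess_le {z : ℝ} (hz : 0 < z) :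
    ∫⁻ x, ENNReal.ofReal (x - z) ∂(gaussianReal 0 1) ≤
      ENNReal.ofReal (1 / z) * gaussianReal 0 1 (Set.Ioi z) := by
  have h1 := lintegral_eq_lintegral_meas_lt (gaussianReal 0 1) (f := fun x => max (x - z) 0)
    (Eventually.of_forall fun x => le_max_right _ _) (by fun_prop)
  have h2 : ∀ x : ℝ, ENNReal.ofReal (max (x - z) 0) = ENNReal.ofReal (x - z) := fun x => by
    rw [ENNReal.ofReal_max, ENNReal.ofReal_zero, max_eq_left zero_le]
  simp only [h2] at h1
  rw [h1]
  calc ∫⁻ t in Set.Ioi 0, gaussianReal 0 1 {a | t < max (a - z) 0}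
      ≤ ∫⁻ t in Set.Ioi 0, ENNReal.ofReal (Real.exp (-z * t)) * gaussianReal 0 1 (Set.Ioi z) := by
        refine setLIntegral_mono' measurableSet_Ioi fun t (ht : 0 < t) => ?_
        have hs : {a : ℝ | t < max (a - z) 0} = Set.Ioi (z + t) := by
          ext a
          simp only [Set.mem_ofPred_eq, lt_max_iff, Set.mem_Ioi]
          constructor
          · rintro (h | h) <;> linarith
          · intro h
            left
            linarith
        rw [hs]
        refine (gaussianReal_Ioi_add_le ht.le).trans ?_
        gcongr
        nlinarith [sq_nonneg t]
    _ = _ := by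
        rw [lintegral_mul_const _ (by fun_prop)]
        congr 1
        rw [← ofReal_integral_eq_lintegral_ofReal
          (integrableOn_exp_mul_Ioi (by linarith) 0)
          (Eventually.of_forall fun x => Real.exp_nonneg _),
          integral_exp_mul_Ioi (by linarith)]
        congr 1
        simp [div_eq_mul_inv]

/-- Dividing the level by `k` raises the squared quantile by at most `2 log k`. -/
lemma zQuantile_div_le {β k : ℝ} (h0 : 0 < β) (h1 : β < 1 / 2) (hk : 1 ≤ k) :
    zQuantile (β / k) ≤ √(2 / zQuantile β ^ 2 * Real.log k + 1) * zQuantile β := by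
  have hz := zQuantile_pos h0 h1
  set z := zQuantile β with hzdef
  have hlog := Real.log_nonneg hk
  set w := √(2 / z ^ 2 * Real.log k + 1) * z with hw
  have hw2 : w ^ 2 = 2 * Real.log k + z ^ 2 := by
    rw [hw, mul_pow, Real.sq_sqrt (by positivity)]
    field_simp
  have hw0 : 0 ≤ w := by positivity
  have hzw : z ≤ w := by
    apply le_of_sq_le_sq _ hw0
    linarith
  have hk0 : 0 < k := by linarith
  have hβk : β / k < 1 := by
    rw [div_lt_one hk0]
    linarith
  apply zQuantile_le hβk
  have h := gaussianReal_Ioi_add_le (z := z) (δ := w - z) (by linarith)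
  have he : Real.exp (-(z * (w - z) + (w - z) ^ 2 / 2)) = 1 / k := by
    rw [show -(z * (w - z) + (w - z) ^ 2 / 2) = -Real.log k by linarith, Real.exp_neg,
      Real.exp_log hk0, one_div]
  rw [he, hzdef, gaussianReal_Ioi_zQuantile h0 (by linarith), ← hzdef,
    ← ENNReal.ofReal_mul (by positivity), add_sub_cancel, gaussianReal_Ioi,
    ENNReal.ofReal_le_ofReal_iff (by positivity)] at h
  rw [div_eq_mul_inv, mul_comm]
  rw [one_div] at h
  linarith

/-! ### Gaussian shift experiments -/

section GaussianShift

variable {I H : Type*} [NormedAddCommGroup H] [InnerProductSpace ℝ H]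

/-- The data `y : I → ℝ` have the Gaussian law with mean `t ↦ ⟪e t, θ⟫` and covariance
`(s, t) ↦ ⟪e s, e t⟫`, expressed through the laws of the finite linear combinations
`∑ t, a t * y t`. Both models are of this form, the noise level being absorbed in `e` and `θ`. -/
def IsGaussianShift (e : I → H) (θ : H) (P : Measure (I → ℝ)) : Prop :=
  ∀ a : I →₀ ℝ, HasLaw (fun y : I → ℝ => Finsupp.linearCombination ℝ y a)
    (gaussianReal (inner ℝ (Finsupp.linearCombination ℝ e a) θ)
      (‖Finsupp.linearCombination ℝ e a‖₊ ^ 2)) P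

/-- `S` is the limit in mean square, under `P`, of `c + ∑ t, a m t * y t`. -/
def IsMeanSquareLimit (P : Measure (I → ℝ)) (c : ℝ) (a : ℕ → I →₀ ℝ) (S : (I → ℝ) → ℝ) : Prop :=
  Tendsto (fun m => eLpNorm (fun y => S y - (c + Finsupp.linearCombination ℝ y (a m))) 2 P)
    atTop (𝓝 0)

lemma measurable_linearCombination_apply (a : I →₀ ℝ) :
    Measurable fun y : I → ℝ => Finsupp.linearCombination ℝ y a := by
  simp only [Finsupp.linearCombination_apply, Finsupp.sum]
  fun_prop

lemma eLpNorm_two_of_hasLaw_gaussianReal {Ω : Type*} [MeasurableSpace Ω] {P : Measure Ω}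
    {X : Ω → ℝ} {m : ℝ} {v : ℝ≥0} (hX : HasLaw X (gaussianReal m v) P) :
    eLpNorm X 2 P = ENNReal.ofReal √(m ^ 2 + v) := by
  have h1 : eLpNorm X 2 P = eLpNorm id 2 (gaussianReal m v) := by
    rw [← hX.map_eq, eLpNorm_map_measure measurable_id.aestronglyMeasurable hX.aemeasurable,
      Function.id_comp]
  have hm : MemLp id 2 (gaussianReal m v) := memLp_id_gaussianReal 2
  have h2 := variance_eq_sub hm
  rw [variance_id_gaussianReal] at h2
  simp only [id_eq, integral_id_gaussianReal, Pi.pow_apply] at h2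
  rw [h1, hm.eLpNorm_eq_integral_rpow_norm (by norm_num) (by norm_num)]
  congr 1
  rw [Real.sqrt_eq_rpow]
  simp only [id_eq, ENNReal.toReal_ofNat, one_div]
  congr 1
  simp only [Real.norm_eq_abs, Real.rpow_ofNat, sq_abs]
  linarith

lemma tendsto_charFun_gaussianReal {m : ℕ → ℝ} {v : ℕ → ℝ≥0} {m' : ℝ} {v' : ℝ≥0}
    (hm : Tendsto m atTop (𝓝 m')) (hv : Tendsto (fun i => (v i : ℝ)) atTop (𝓝 (v' : ℝ))) (t : ℝ) :
    Tendsto (fun i => charFun (gaussianReal (m i) (v i)) t) atTop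
      (𝓝 (charFun (gaussianReal m' v') t)) := by
  simp_rw [charFun_gaussianReal]
  have hc : Continuous fun p : ℝ × ℝ =>
      Complex.exp (t * p.1 * Complex.I - p.2 * t ^ 2 / 2) := by fun_prop
  have h := (hc.tendsto (m', (v' : ℝ))).comp (hm.prodMk_nhds hv)
  simpa only [Function.comp_def] using h

namespace IsGaussianShift

variable {e : I → H} {θ : H} {P : Measure (I → ℝ)}

lemma isProbabilityMeasure (h : IsGaussianShift e θ P) : IsProbabilityMeasure P :=
  (h 0).isProbabilityMeasure

lemma hasLaw_const_add (h : IsGaussianShift e θ P) (c : ℝ) (a : I →₀ ℝ) :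
    HasLaw (fun y : I → ℝ => c + Finsupp.linearCombination ℝ y a)
      (gaussianReal (c + inner ℝ (Finsupp.linearCombination ℝ e a) θ)
        (‖Finsupp.linearCombination ℝ e a‖₊ ^ 2)) P := by
  rw [add_comm c (inner ℝ _ _)]
  exact gaussianReal_const_add (h a) c

lemma eLpNorm_le (h : IsGaussianShift e θ P) (a : I →₀ ℝ) :
    eLpNorm (fun y : I → ℝ => Finsupp.linearCombination ℝ y a) 2 P ≤
      ENNReal.ofReal ((‖θ‖ + 1) * ‖Finsupp.linearCombination ℝ e a‖) := by
  rw [eLpNorm_two_of_hasLaw_gaussianReal (h a)]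
  refine ENNReal.ofReal_le_ofReal (Real.sqrt_le_iff.2 ⟨by positivity, ?_⟩)
  have h1 := abs_real_inner_le_norm (Finsupp.linearCombination ℝ e a) θ
  have h2 := sq_le_sq' (neg_le_of_abs_le h1) (le_of_abs_le h1)
  push_cast
  have h3 : 0 ≤ ‖θ‖ * ‖Finsupp.linearCombination ℝ e a‖ ^ 2 := by positivity
  nlinarith

lemma le_eLpNorm (h : IsGaussianShift e θ P) (a : I →₀ ℝ) :
    ENNReal.ofReal ‖Finsupp.linearCombination ℝ e a‖ ≤
      eLpNorm (fun y : I → ℝ => Finsupp.linearCombination ℝ y a) 2 P := by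
  rw [eLpNorm_two_of_hasLaw_gaussianReal (h a)]
  refine ENNReal.ofReal_le_ofReal (Real.le_sqrt_of_sq_le ?_)
  push_cast
  nlinarith [sq_nonneg (inner ℝ (Finsupp.linearCombination ℝ e a) θ)]

/-- Mean-square limits of Gaussian variables are Gaussian, with the limiting mean and variance. -/
lemma hasLaw_of_isMeanSquareLimit (h : IsGaussianShift e θ P) {c : ℝ} {a : ℕ → I →₀ ℝ}
    {S : (I → ℝ) → ℝ} (hS : Measurable S) (hlim : IsMeanSquareLimit P c a S) {u : H}
    (hu : Tendsto (fun m => Finsupp.linearCombination ℝ e (a m)) atTop (𝓝 u)) :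
    HasLaw S (gaussianReal (c + inner ℝ u θ) (‖u‖₊ ^ 2)) P := by
  have := h.isProbabilityMeasure
  refine ⟨hS.aemeasurable, ?_⟩
  have hmeas : ∀ m, Measurable fun y : I → ℝ => c + Finsupp.linearCombination ℝ y (a m) :=
    fun m => (measurable_linearCombination_apply _).const_add c
  have hprob : TendstoInMeasure P
      (fun m (y : I → ℝ) => c + Finsupp.linearCombination ℝ y (a m)) atTop S := by
    refine tendstoInMeasure_of_tendsto_eLpNorm (p := 2) (by norm_num)
      (fun m => (hmeas m).aestronglyMeasurable) hS.aestronglyMeasurable ?_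
    refine hlim.congr fun m => ?_
    rw [← eLpNorm_neg]
    congr 1
    ext y
    simp
  obtain ⟨ns, hns, hae⟩ := hprob.exists_seq_tendsto_ae
  have : IsProbabilityMeasure (P.map S) := Measure.isProbabilityMeasure_map hS.aemeasurable
  refine Measure.ext_of_charFun (funext fun t => ?_)
  have hcf : ∀ {X : (I → ℝ) → ℝ}, Measurable X →
      charFun (P.map X) t = ∫ y, Complex.exp (t * X y * Complex.I) ∂P := fun hX => by
    rw [charFun_apply_real, integral_map hX.aemeasurable]
    fun_prop
  have h1 : Tendsto (fun i => charFun (P.map fun y : I → ℝ =>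
      c + Finsupp.linearCombination ℝ y (a (ns i))) t) atTop (𝓝 (charFun (P.map S) t)) := by
    rw [hcf hS]
    simp_rw [hcf (hmeas _)]
    refine tendsto_integral_of_dominated_convergence (fun _ => 1) (fun n => ?_)
      (integrable_const _) (fun n => Eventually.of_forall fun y => ?_) ?_
    · have := hmeas (ns n)
      exact Measurable.aestronglyMeasurable (by fun_prop)
    · rw [← Complex.ofReal_mul, Complex.norm_exp_ofReal_mul_I]
    · filter_upwards [hae] with y hy
      have : Continuous fun x : ℝ => Complex.exp (t * x * Complex.I) := by fun_prop
      exact (this.tendsto _).comp hy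
  refine tendsto_nhds_unique h1 ?_
  simp_rw [(h.hasLaw_const_add c _).map_eq]
  have hu' := hu.comp hns.tendsto_atTop
  have hm : Tendsto (fun i => c + inner ℝ (Finsupp.linearCombination ℝ e (a (ns i))) θ) atTop
      (𝓝 (c + inner ℝ u θ)) := (hu'.inner tendsto_const_nhds).const_add c
  have hv : Tendsto (fun i => ((‖Finsupp.linearCombination ℝ e (a (ns i))‖₊ ^ 2 : ℝ≥0) : ℝ)) atTop
      (𝓝 ((‖u‖₊ ^ 2 : ℝ≥0) : ℝ)) := by
    push_cast
    exact hu'.norm.pow 2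
  exact tendsto_charFun_gaussianReal hm hv t

/-- The coefficients of a mean-square convergent sequence converge in the Hilbert space. -/
lemma exists_tendsto_of_isMeanSquareLimit [CompleteSpace H] (h : IsGaussianShift e θ P) {c : ℝ}
    {a : ℕ → I →₀ ℝ} {S : (I → ℝ) → ℝ} (hS : Measurable S) (hlim : IsMeanSquareLimit P c a S) :
    ∃ u, Tendsto (fun m => Finsupp.linearCombination ℝ e (a m)) atTop (𝓝 u) := by
  refine cauchySeq_tendsto_of_complete (EMetric.cauchySeq_iff.2 fun ε hε => ?_)
  have hε2 : (0 : ℝ≥0∞) < ε / 2 := ENNReal.half_pos hε.ne'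
  obtain ⟨N, hN⟩ := eventually_atTop.1 (hlim.eventually_lt_const hε2)
  refine ⟨N, fun m hm n hn => ?_⟩
  have hmeas : ∀ m, AEStronglyMeasurable
      (fun y : I → ℝ => S y - (c + Finsupp.linearCombination ℝ y (a m))) P := fun m =>
    (hS.sub ((measurable_linearCombination_apply _).const_add c)).aestronglyMeasurable
  have h1 := h.le_eLpNorm (a m - a n)
  rw [map_sub] at h1
  rw [edist_eq_enorm_sub, ← ofReal_norm]
  refine h1.trans_lt ?_
  have h2 : (fun y : I → ℝ => Finsupp.linearCombination ℝ y (a m - a n)) =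
      (fun y => S y - (c + Finsupp.linearCombination ℝ y (a n))) -
        fun y => S y - (c + Finsupp.linearCombination ℝ y (a m)) := by
    ext y
    simp only [map_sub, Pi.sub_apply]
    ring
  rw [h2]
  calc _ ≤ _ := eLpNorm_sub_le (hmeas n) (hmeas m) (by norm_num)
    _ < ε / 2 + ε / 2 := ENNReal.add_lt_add (hN n hn) (hN m hm)
    _ = ε := ENNReal.add_halves ε

end IsGaussianShift

/-- The Wiener integral `∫ u dY`, for `u` in the closed span of `e`: one and the same function of
the data and sequence of coefficients serve every shift `θ`. The sequence converges so fast that the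
approximations converge almost surely. -/
lemma exists_wienerIntegral {e : I → H} {u : H}
    (hu : u ∈ closure (Submodule.span ℝ (Set.range e) : Set H)) :
    ∃ (S : (I → ℝ) → ℝ) (a : ℕ → I →₀ ℝ), Measurable S ∧
      Tendsto (fun m => Finsupp.linearCombination ℝ e (a m)) atTop (𝓝 u) ∧
      ∀ θ P, IsGaussianShift e θ P → IsMeanSquareLimit P 0 a S := by
  have hex : ∀ m : ℕ, ∃ a : I →₀ ℝ, ‖Finsupp.linearCombination ℝ e a - u‖ < (1 / 2) ^ m := by
    intro m
    obtain ⟨w, hw, hd⟩ := Metric.mem_closure_iff.1 hu ((1 / 2) ^ m) (by positivity)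
    rw [← Finsupp.range_linearCombination] at hw
    obtain ⟨a, rfl⟩ := hw
    exact ⟨a, by rwa [← dist_eq_norm, dist_comm]⟩
  choose a ha using hex
  refine ⟨fun y => limsup (fun m => Finsupp.linearCombination ℝ y (a m)) atTop, a,
    Measurable.limsup fun m => measurable_linearCombination_apply _, ?_, fun θ P h => ?_⟩
  · rw [tendsto_iff_norm_sub_tendsto_zero]
    exact squeeze_zero (fun _ => norm_nonneg _) (fun m => (ha m).le)
      (tendsto_pow_atTop_nhds_zero_of_lt_one (by norm_num) (by norm_num))
  set K : ℝ := (‖θ‖ + 1) * 2 with hK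
  have hK0 : 0 < K := by positivity
  have hmeas : ∀ m, AEStronglyMeasurable
      (fun y : I → ℝ => Finsupp.linearCombination ℝ y (a m)) P := fun m =>
    (measurable_linearCombination_apply _).aestronglyMeasurable
  have hB : ∑' m : ℕ, ENNReal.ofReal (K * (1 / 2) ^ m) ≠ ∞ :=
    (summable_geometric_two.mul_left K).tsum_ofReal_ne_top
  have hcau : ∀ N n m : ℕ, N ≤ n → N ≤ m →
      eLpNorm ((fun y : I → ℝ => Finsupp.linearCombination ℝ y (a n)) -
        fun y => Finsupp.linearCombination ℝ y (a m)) 2 P < ENNReal.ofReal (K * (1 / 2) ^ N) := by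
    intro N n m hn hm
    have h1 : ((fun y : I → ℝ => Finsupp.linearCombination ℝ y (a n)) -
        fun y => Finsupp.linearCombination ℝ y (a m)) =
        fun y => Finsupp.linearCombination ℝ y (a n - a m) := by
      ext y
      simp
    rw [h1]
    refine (h.eLpNorm_le _).trans_lt ((ENNReal.ofReal_lt_ofReal_iff (by positivity)).2 ?_)
    rw [hK, mul_assoc]
    gcongr
    rw [map_sub, ← sub_sub_sub_cancel_right _ _ u]
    have hpow : ∀ {j : ℕ}, N ≤ j → (1 / 2 : ℝ) ^ j ≤ (1 / 2) ^ N := fun hj =>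
      pow_le_pow_of_le_one (by norm_num) (by norm_num) hj
    linarith [norm_sub_le (Finsupp.linearCombination ℝ e (a n) - u)
      (Finsupp.linearCombination ℝ e (a m) - u), ha n, ha m, hpow hn, hpow hm]
  have hae := Lp.ae_tendsto_of_cauchy_eLpNorm hmeas (p := 2) (by norm_num) hB hcau
  have hlim := Lp.cauchy_tendsto_of_tendsto hmeas
    (fun y => limsup (fun m => Finsupp.linearCombination ℝ y (a m)) atTop) hB hcau (by
      filter_upwards [hae] with y hy
      obtain ⟨l, hl⟩ := hy
      rwa [hl.limsup_eq])
  refine hlim.congr fun m => ?_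
  rw [← eLpNorm_neg]
  congr 1
  ext y
  simp

end GaussianShift

/-! ### The Cameron–Martin density and two-point testing -/

section TwoPoint

variable {I H : Type*} [NormedAddCommGroup H] [InnerProductSpace ℝ H]

/-- A finite measure on `I → ℝ` is determined by the laws of the finite linear combinations of the
coordinates. -/
lemma measure_ext_of_map_linearCombination {μ ν : Measure (I → ℝ)} [IsFiniteMeasure μ]
    [IsFiniteMeasure ν]
    (h : ∀ a : I →₀ ℝ, μ.map (fun y : I → ℝ => Finsupp.linearCombination ℝ y a) =
      ν.map fun y : I → ℝ => Finsupp.linearCombination ℝ y a) : μ = ν := by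
  classical
  refine IsProjectiveLimit.unique (P := fun J => ν.map J.restrict) (fun J => ?_) fun J => rfl
  refine Measure.ext_of_charFunDual (funext fun L => ?_)
  rw [charFunDual_eq_charFun_map_one, charFunDual_eq_charFun_map_one,
    Measure.map_map L.continuous.measurable (Finset.measurable_restrict J),
    Measure.map_map L.continuous.measurable (Finset.measurable_restrict J)]
  have hL : (L ∘ J.restrict : (I → ℝ) → ℝ) = fun y => Finsupp.linearCombination ℝ y
      (∑ t : J, Finsupp.single t.1 (L (Pi.single t 1))) := by
    ext y
    have h1 := LinearMap.pi_apply_eq_sum_univ (L : (J → ℝ) →ₗ[ℝ] ℝ) (J.restrict y)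
    simp only [map_sum, Finsupp.linearCombination_single, Function.comp_apply, smul_eq_mul]
    refine h1.trans (Finset.sum_congr rfl fun t _ => ?_)
    have h2 : (Pi.single t 1 : J → ℝ) = fun j => if t = j then 1 else 0 := by
      ext s
      simp [Pi.single_apply, eq_comm]
    rw [smul_eq_mul, mul_comm, h2]
    rfl
  rw [hL, h]

lemma IsMeanSquareLimit.add_linearCombination {P : Measure (I → ℝ)} {c : ℝ} {a : ℕ → I →₀ ℝ}
    {S : (I → ℝ) → ℝ} (h : IsMeanSquareLimit P c a S) (b : I →₀ ℝ) :
    IsMeanSquareLimit P c (fun m => a m + b) fun y => S y + Finsupp.linearCombination ℝ y b := by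
  refine h.congr fun m => ?_
  congr 1
  ext y
  rw [map_add]
  ring

lemma integrable_exp_of_hasLaw_gaussianReal {Ω : Type*} [MeasurableSpace Ω] {P : Measure Ω}
    {X : Ω → ℝ} {m : ℝ} {v : ℝ≥0} (hX : HasLaw X (gaussianReal m v) P) (t : ℝ) :
    Integrable (fun ω => Real.exp (t * X ω)) P := by
  have h := integrable_exp_mul_gaussianReal (μ := m) (v := v) t
  rw [← hX.map_eq] at h
  exact h.comp_aemeasurable hX.aemeasurable

lemma integral_exp_of_hasLaw_gaussianReal {Ω : Type*} [MeasurableSpace Ω] {P : Measure Ω}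
    {X : Ω → ℝ} {m : ℝ} {v : ℝ≥0} (hX : HasLaw X (gaussianReal m v) P) :
    ∫ ω, Real.exp (X ω) ∂P = Real.exp (m + v / 2) := by
  simpa [mgf] using mgf_gaussianReal hX.map_eq 1

/-- Cameron–Martin: shifting by `h = θ₁ - θ₀` multiplies the law by the density
`exp (∫ h dY - ⟪h, θ₀⟫ - ‖h‖² / 2)`. Both sides give every finite linear combination of the data
the same moment generating function. -/
lemma IsGaussianShift.eq_withDensity {e : I → H} {θ₀ θ₁ : H} {P₀ P₁ : Measure (I → ℝ)}
    (h₀ : IsGaussianShift e θ₀ P₀) (h₁ : IsGaussianShift e θ₁ P₁) {S : (I → ℝ) → ℝ}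
    {a : ℕ → I →₀ ℝ} (hS : Measurable S)
    (ha : Tendsto (fun m => Finsupp.linearCombination ℝ e (a m)) atTop (𝓝 (θ₁ - θ₀)))
    (hlim : IsMeanSquareLimit P₀ 0 a S) :
    P₁ = P₀.withDensity fun y =>
      ENNReal.ofReal (Real.exp (S y - inner ℝ (θ₁ - θ₀) θ₀ - ‖θ₁ - θ₀‖ ^ 2 / 2)) := by
  have := h₀.isProbabilityMeasure
  have := h₁.isProbabilityMeasure
  set K : ℝ := inner ℝ (θ₁ - θ₀) θ₀ + ‖θ₁ - θ₀‖ ^ 2 / 2 with hK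
  have hρ : ∀ y, Real.exp (S y - inner ℝ (θ₁ - θ₀) θ₀ - ‖θ₁ - θ₀‖ ^ 2 / 2) =
      Real.exp (-K) * Real.exp (S y) := fun y => by
    rw [← Real.exp_add]
    congr 1
    rw [hK]
    ring
  simp_rw [hρ]
  have hlaw : ∀ b : I →₀ ℝ, HasLaw (fun y => S y + Finsupp.linearCombination ℝ y b)
      (gaussianReal (0 + inner ℝ (θ₁ - θ₀ + Finsupp.linearCombination ℝ e b) θ₀)
        (‖θ₁ - θ₀ + Finsupp.linearCombination ℝ e b‖₊ ^ 2)) P₀ := fun b => by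
    refine h₀.hasLaw_of_isMeanSquareLimit (hS.add (measurable_linearCombination_apply b))
      (hlim.add_linearCombination b) ?_
    simp_rw [map_add]
    exact ha.add_const _
  have hint : Integrable (fun y => Real.exp (-K) * Real.exp (S y)) P₀ := by
    have := integrable_exp_of_hasLaw_gaussianReal (hlaw 0) 1
    simp only [map_zero, add_zero, one_mul] at this
    exact this.const_mul _
  have hfin := isFiniteMeasure_withDensity_ofReal hint.hasFiniteIntegral
  refine measure_ext_of_map_linearCombination fun b => ?_
  have hmgf : mgf (fun y : I → ℝ => Finsupp.linearCombination ℝ y b) P₁ =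
      mgf (fun y : I → ℝ => Finsupp.linearCombination ℝ y b)
        (P₀.withDensity fun y => ENNReal.ofReal (Real.exp (-K) * Real.exp (S y))) := by
    ext s
    rw [mgf_gaussianReal (h₁ b).map_eq, mgf, integral_withDensity_eq_integral_toReal_smul
      (by fun_prop) (Eventually.of_forall fun y => ENNReal.ofReal_lt_top)]
    have hexp : ∀ y : I → ℝ, (ENNReal.ofReal (Real.exp (-K) * Real.exp (S y))).toReal •
        Real.exp (s * Finsupp.linearCombination ℝ y b) =
        Real.exp (-K) * Real.exp (S y + Finsupp.linearCombination ℝ y (s • b)) := fun y => by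
      rw [ENNReal.toReal_ofReal (by positivity), smul_eq_mul, Real.exp_add, map_smul, smul_eq_mul,
        mul_assoc]
    simp_rw [hexp]
    rw [integral_const_mul, integral_exp_of_hasLaw_gaussianReal (hlaw (s • b)), ← Real.exp_add]
    congr 1
    push_cast
    rw [hK, norm_add_sq_real, map_smul, inner_add_left, inner_smul_left, inner_smul_right,
      norm_smul, mul_pow, Real.norm_eq_abs, sq_abs,
      inner_sub_left θ₁ θ₀ (Finsupp.linearCombination ℝ e b), real_inner_comm _ θ₁,
      real_inner_comm _ θ₀]
    simp only [conj_trivial]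
    ring
  refine Measure.ext_of_complexMGF_eq (measurable_linearCombination_apply b).aemeasurable
    (measurable_linearCombination_apply b).aemeasurable (funext fun z => ?_)
  refine eqOn_complexMGF_of_mgf hmgf ?_
  have huniv : integrableExpSet (fun y : I → ℝ => Finsupp.linearCombination ℝ y b) P₁ =
      Set.univ :=
    Set.eq_univ_of_forall fun t => integrable_exp_of_hasLaw_gaussianReal (h₁ b) t
  rw [huniv, interior_univ]
  exact Set.mem_univ _

lemma measure_le_of_hasLaw_gaussianReal {Ω : Type*} [MeasurableSpace Ω] {P : Measure Ω}
    {X : Ω → ℝ} {m d : ℝ} {v : ℝ≥0} (hd : 0 < d) (hv : (v : ℝ) = d ^ 2)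
    (hX : HasLaw X (gaussianReal m v) P) (x : ℝ) :
    P {ω | X ω ≤ x} = ENNReal.ofReal (cdf (gaussianReal 0 1) ((x - m) / d)) := by
  have h1 : HasLaw (fun y : ℝ => m + d * y) (gaussianReal m v) (gaussianReal 0 1) := by
    have h2 := gaussianReal_const_add (gaussianReal_const_mul
      (HasLaw.id (μ := gaussianReal 0 1)) d) m
    have h3 : v = NNReal.mk (d ^ 2) (sq_nonneg d) * 1 := NNReal.eq (by simp [hv])
    rw [mul_zero, zero_add, ← h3] at h2
    exact h2
  rw [hX.measure_eq measurableSet_Iic, ← h1.measure_eq measurableSet_Iic, ofReal_cdf]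
  congr 1
  ext y
  simp only [Set.mem_ofPred_eq, Set.mem_Iic, le_div_iff₀ hd]
  constructor <;> intro h <;> linarith

/-- Neyman–Pearson for a Gaussian shift of size at most `z_α`: an event of probability at least
`1 - α` keeps probability at least `1 / 2`. The complement is compared with the half-space
`{∫ h dY ≤ ⟪h, θ₀⟫}`, which has probability `1 / 2` before and at least `α` after the shift. -/
lemma IsGaussianShift.half_le_of_le {e : I → H} {θ₀ θ₁ : H} {P₀ P₁ : Measure (I → ℝ)}
    (h₀ : IsGaussianShift e θ₀ P₀) (h₁ : IsGaussianShift e θ₁ P₁)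
    (he : Dense (Submodule.span ℝ (Set.range e) : Set H)) {α : ℝ} (hα : 0 < α) (hα' : α < 1 / 2)
    (hθ : ‖θ₁ - θ₀‖ ≤ zQuantile α) {A : Set (I → ℝ)} (hA : MeasurableSet A)
    (hP : ENNReal.ofReal (1 - α) ≤ P₁ A) : ENNReal.ofReal (1 / 2) ≤ P₀ A := by
  have := h₀.isProbabilityMeasure
  have := h₁.isProbabilityMeasure
  rcases eq_or_ne θ₁ θ₀ with rfl | hne
  · have : P₀ = P₁ := measure_ext_of_map_linearCombination fun a => by
      rw [(h₀ a).map_eq, (h₁ a).map_eq]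
    rw [this]
    exact (ENNReal.ofReal_le_ofReal (by linarith)).trans hP
  set d := ‖θ₁ - θ₀‖ with hd
  have hd0 : 0 < d := norm_pos_iff.2 (sub_ne_zero.2 hne)
  obtain ⟨S, a, hS, ha, hlim⟩ := exists_wienerIntegral (he (θ₁ - θ₀))
  have hdens := h₀.eq_withDensity h₁ hS ha (hlim _ _ h₀)
  have hlaw₀ := h₀.hasLaw_of_isMeanSquareLimit hS (hlim _ _ h₀) ha
  have hlaw₁ := h₁.hasLaw_of_isMeanSquareLimit hS (hlim _ _ h₁) ha
  set c : ℝ := inner ℝ (θ₁ - θ₀) θ₀ with hc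
  set N : Set (I → ℝ) := {y | S y ≤ c} with hN
  have hNm : MeasurableSet N := hS measurableSet_Iic
  have hN₀ : P₀ N = ENNReal.ofReal (1 / 2) := by
    rw [hN, measure_le_of_hasLaw_gaussianReal hd0 (by simp [hd]) hlaw₀, zero_add, sub_self,
      zero_div, cdf_gaussian_zero]
  have hN₁ : ENNReal.ofReal α ≤ P₁ N := by
    rw [hN, measure_le_of_hasLaw_gaussianReal hd0 (by simp [hd]) hlaw₁]
    refine ENNReal.ofReal_le_ofReal ?_
    have h2 : (c - (0 + inner ℝ (θ₁ - θ₀) θ₁)) / d = -d := by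
      rw [zero_add, hc, ← inner_sub_right, ← neg_sub θ₁ θ₀, inner_neg_right,
        real_inner_self_eq_norm_sq, ← hd]
      field_simp
    rw [h2, cdf_gaussian_neg]
    have := monotone_cdf (gaussianReal 0 1) hθ
    rw [cdf_zQuantile hα (by linarith)] at this
    linarith
  have hB₁ : P₁ Aᶜ ≤ ENNReal.ofReal α := by
    rw [prob_compl_eq_one_sub hA]
    refine tsub_le_iff_right.2 ?_
    calc (1 : ℝ≥0∞) = ENNReal.ofReal α + ENNReal.ofReal (1 - α) := by
          rw [← ENNReal.ofReal_add hα.le (by linarith)]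
          simp
      _ ≤ _ := by gcongr
  set ρ : (I → ℝ) → ℝ≥0∞ := fun y => ENNReal.ofReal (Real.exp (S y - c - d ^ 2 / 2)) with hρ
  have hρm : Measurable ρ := by fun_prop
  set ρ₀ : ℝ≥0∞ := ENNReal.ofReal (Real.exp (-(d ^ 2 / 2))) with hρ₀
  have key : P₁ N + ρ₀ * P₀ Aᶜ ≤ P₁ Aᶜ + ρ₀ * P₀ N := by
    rw [hdens, withDensity_apply _ hNm, withDensity_apply _ hA.compl, ← lintegral_indicator hNm,
      ← lintegral_indicator hA.compl, ← lintegral_indicator_const hA.compl,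
      ← lintegral_indicator_const hNm, ← lintegral_add_left (hρm.indicator hNm),
      ← lintegral_add_left (hρm.indicator hA.compl)]
    refine lintegral_mono fun y => ?_
    by_cases hy : y ∈ N <;> by_cases hyA : y ∈ Aᶜ <;>
      simp only [Set.indicator_of_mem, Set.indicator_of_notMem, hy, hyA, not_false_eq_true,
        add_zero, zero_add, le_refl]
    · refine ENNReal.ofReal_le_ofReal (Real.exp_le_exp.2 ?_)
      have : S y ≤ c := hy
      linarith
    · refine ENNReal.ofReal_le_ofReal (Real.exp_le_exp.2 ?_)
      have : ¬ S y ≤ c := hy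
      linarith
  have hB₀ : P₀ Aᶜ ≤ ENNReal.ofReal (1 / 2) := by
    rw [← hN₀]
    have h3 : P₁ N + ρ₀ * P₀ Aᶜ ≤ P₁ N + ρ₀ * P₀ N := by
      refine key.trans ?_
      exact add_le_add_left (hB₁.trans hN₁) _
    have h4 := (ENNReal.add_le_add_iff_left (measure_ne_top P₁ N)).1 h3
    exact (ENNReal.mul_le_mul_iff_right (by simp [Real.exp_pos]) ENNReal.ofReal_ne_top).1 h4
  have h5 := prob_add_prob_compl (μ := P₀) hA
  have h6 : (1 : ℝ≥0∞) = ENNReal.ofReal (1 / 2) + ENNReal.ofReal (1 / 2) := by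
    rw [← ENNReal.ofReal_add (by norm_num) (by norm_num)]
    norm_num
  rw [h6] at h5
  refine (ENNReal.add_le_add_iff_right ENNReal.ofReal_ne_top).1 (h5.symm.le.trans ?_)
  gcongr

lemma measurableSet_mem_of_isRandomInterval {X : Type*} [MeasurableSpace X] {C : X → Set ℝ}
    (hC : IsRandomInterval C) (x : ℝ) : MeasurableSet {y | x ∈ C y} := by
  obtain ⟨lo, hi, hlo, hhi, h⟩ := hC
  simp_rw [h, Set.mem_ofPred_eq, Set.ofPred_and]
  exact (measurableSet_le hlo measurable_const).inter (measurableSet_le measurable_const hhi)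

/-- Two-point bound: an interval which covers both `T f` and `T g` with probability `1 - α`, where
`f` and `g` are within `z_α` standard deviations of each other, covers both at once under `f` with
probability at least `1 / 2 - α`, and is then at least `|T g - T f|` long. -/
lemma le_lintegral_volume_of_mem_confidenceIntervals {Θ : Type*} {e : I → H} {ι : Θ → H}
    {P : Θ → Measure (I → ℝ)} (hP : ∀ f, IsGaussianShift e (ι f) (P f))
    (he : Dense (Submodule.span ℝ (Set.range e) : Set H)) {T : Θ → ℝ} {α : ℝ} (hα : 0 < α)
    (hα' : α < 1 / 2) {G : Set Θ} {C : (I → ℝ) → Set ℝ} (hC : C ∈ confidenceIntervals P T α G)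
    {f g : Θ} (hf : f ∈ G) (hg : g ∈ G) (hfg : ‖ι g - ι f‖ ≤ zQuantile α) :
    ENNReal.ofReal ((1 / 2 - α) * |T g - T f|) ≤ ∫⁻ y, volume (C y) ∂(P f) := by
  have := (hP f).isProbabilityMeasure
  obtain ⟨hCi, hcov⟩ := hC
  have hAf := measurableSet_mem_of_isRandomInterval hCi (T f)
  have hAg := measurableSet_mem_of_isRandomInterval hCi (T g)
  have h1 := hcov f hf
  have h2 := (hP f).half_le_of_le (hP g) he hα hα' hfg hAg (hcov g hg)
  set A := {y | T f ∈ C y}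
  set B := {y | T g ∈ C y}
  have h3 : ENNReal.ofReal (1 / 2 - α) ≤ P f (A ∩ B) := by
    have h4 := measure_union_add_inter (μ := P f) A hAg
    have h5 : ENNReal.ofReal (1 / 2 - α) + 1 ≤ P f (A ∩ B) + 1 := by
      calc ENNReal.ofReal (1 / 2 - α) + 1
          = ENNReal.ofReal (1 - α) + ENNReal.ofReal (1 / 2) := by
            rw [← ENNReal.ofReal_one, ← ENNReal.ofReal_add (by linarith) (by norm_num),
              ← ENNReal.ofReal_add (by linarith) (by norm_num)]
            congr 1
            ring
        _ ≤ P f A + P f B := by gcongr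
        _ = P f (A ∪ B) + P f (A ∩ B) := h4.symm
        _ ≤ 1 + P f (A ∩ B) := by gcongr; exact prob_le_one
        _ = _ := add_comm _ _
    exact (ENNReal.add_le_add_iff_right ENNReal.one_ne_top).1 h5
  calc ENNReal.ofReal ((1 / 2 - α) * |T g - T f|)
      = ENNReal.ofReal |T g - T f| * ENNReal.ofReal (1 / 2 - α) := by
        rw [mul_comm, ENNReal.ofReal_mul (abs_nonneg _)]
    _ ≤ ENNReal.ofReal |T g - T f| * P f (A ∩ B) := by gcongr
    _ = ∫⁻ _ in A ∩ B, ENNReal.ofReal |T g - T f| ∂(P f) := by rw [setLIntegral_const]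
    _ ≤ ∫⁻ y in A ∩ B, volume (C y) ∂(P f) := by
        refine setLIntegral_mono' (hAf.inter hAg) fun y hy => ?_
        rw [← Real.volume_interval]
        refine measure_mono ?_
        obtain ⟨lo, hi, -, -, h⟩ := hCi
        have hyf : T f ∈ C y := hy.1
        have hyg : T g ∈ C y := hy.2
        rw [h, Set.mem_ofPred_eq] at hyf hyg
        intro x hx
        rw [h, Set.mem_ofPred_eq]
        rcases Set.mem_uIcc.1 hx with hx | hx
        · exact ⟨hyf.1.trans (EReal.coe_le_coe_iff.2 hx.1),
            (EReal.coe_le_coe_iff.2 hx.2).trans hyg.2⟩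
        · exact ⟨hyg.1.trans (EReal.coe_le_coe_iff.2 hx.1),
            (EReal.coe_le_coe_iff.2 hx.2).trans hyf.2⟩
    _ ≤ _ := setLIntegral_le_lintegral _ _

end TwoPoint

/-! ### Affine functionals sandwiched by the modulus of continuity -/

section Sandwich

variable {V H : Type*} [AddCommGroup V] [Module ℝ V] [NormedAddCommGroup H] [InnerProductSpace ℝ H]

/-- Two convex sets with a common point `h₀` can be shrunk towards `h₀` simultaneously. -/
lemma exists_sub_eq_smul_sub {F G : Set V} (hF : Convex ℝ F) (hG : Convex ℝ G)
    (hFG : (F ∩ G).Nonempty) {f g : V} (hf : f ∈ F) (hg : g ∈ G) {r : ℝ} (h0 : 0 ≤ r)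
    (h1 : r ≤ 1) : ∃ f' ∈ F, ∃ g' ∈ G, g' - f' = r • (g - f) := by
  obtain ⟨h₀, hF₀, hG₀⟩ := hFG
  refine ⟨r • f + (1 - r) • h₀, hF hf hF₀ h0 (by linarith) (by ring),
    r • g + (1 - r) • h₀, hG hg hG₀ h0 (by linarith) (by ring), ?_⟩
  rw [smul_sub]
  abel

/-- If `T g - T f ≤ w` whenever `‖ι g - ι f‖ ≤ ε`, then shrinking gives
`T g - T f ≤ w + (w / ε) ‖ι g - ι f‖` for all `f ∈ F` and `g ∈ G`. -/
lemma sub_le_add_mul_norm {ι : V →ₗ[ℝ] H} {T : V →ₗ[ℝ] ℝ} {F G : Set V} (hF : Convex ℝ F)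
    (hG : Convex ℝ G) (hFG : (F ∩ G).Nonempty) {w ε : ℝ} (hw : 0 ≤ w) (hε : 0 < ε)
    (hmod : ∀ f ∈ F, ∀ g ∈ G, ‖ι (g - f)‖ ≤ ε → T g - T f ≤ w) {f g : V} (hf : f ∈ F)
    (hg : g ∈ G) : T (g - f) ≤ w + w / ε * ‖ι (g - f)‖ := by
  rcases le_or_gt ‖ι (g - f)‖ ε with h | h
  · have := hmod f hf g hg h
    rw [map_sub]
    have : 0 ≤ w / ε * ‖ι (g - f)‖ := by positivity
    linarith
  · have hpos : 0 < ‖ι (g - f)‖ := hε.trans h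
    obtain ⟨f', hf', g', hg', heq⟩ := exists_sub_eq_smul_sub hF hG hFG hf hg
      (r := ε / ‖ι (g - f)‖) (by positivity) ((div_le_one hpos).2 h.le)
    have h1 := hmod f' hf' g' hg' (by
      rw [heq, map_smul, norm_smul, Real.norm_of_nonneg (by positivity),
        div_mul_cancel₀ _ hpos.ne'])
    rw [← map_sub, heq, map_smul, smul_eq_mul, div_mul_eq_mul_div, div_le_iff₀ hpos] at h1
    have h2 : T (g - f) ≤ w / ε * ‖ι (g - f)‖ := by
      rw [div_mul_eq_mul_div, le_div_iff₀ hε]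
      linarith
    linarith

open scoped Pointwise in
/-- Hahn–Banach sandwich: the graph of `T` over the differences `g - f` lies below the convex
function `h ↦ w + s ‖h‖`, hence below a continuous affine function whose slope has norm at most `s`
and whose value at `0` is at most `w`. No continuity of `T` is needed, since the upper function is
continuous. -/
lemma exists_inner_sandwich [CompleteSpace H] {ι : V →ₗ[ℝ] H} {T : V →ₗ[ℝ] ℝ} {F G : Set V}
    (hF : Convex ℝ F) (hG : Convex ℝ G) (hFG : (F ∩ G).Nonempty) {w s : ℝ}
    (hs : 0 ≤ s)
    (hT : ∀ f ∈ F, ∀ g ∈ G, T (g - f) ≤ w + s * ‖ι (g - f)‖) :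
    ∃ u : H, ‖u‖ ≤ s ∧ ∀ f ∈ F, ∀ g ∈ G, T (g - f) ≤ w + inner ℝ u (ι (g - f)) := by
  set epi : Set (H × ℝ) := {p | w + s * ‖p.1‖ < p.2} with hepi
  set graph : Set (H × ℝ) := (ι.prod T) '' (G - F) with hgraph
  have hconv : Convex ℝ epi := by
    have hc : ConvexOn ℝ Set.univ fun h : H => w + s * ‖h‖ :=
      (convexOn_const w convex_univ).add ((convexOn_norm convex_univ).smul hs)
    have := hc.convex_strict_epigraph
    simpa using this
  have hopen : IsOpen epi := isOpen_lt (by fun_prop) (by fun_prop)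
  have hdisj : Disjoint epi graph := by
    rw [Set.disjoint_left]
    rintro p hp ⟨d, hd, rfl⟩
    obtain ⟨g, hg, f, hf, rfl⟩ := Set.mem_sub.1 hd
    have h1 : w + s * ‖ι (g - f)‖ < T (g - f) := hp
    exact absurd (hT f hf g hg) (not_le.2 h1)
  obtain ⟨φ, v, hlt, hle⟩ := geometric_hahn_banach_open hconv hopen
    ((hG.sub hF).linear_image (ι.prod T)) hdisj
  have hsplit : ∀ (h : H) (r : ℝ), φ (h, r) = φ (h, 0) + r * φ (0, 1) := fun h r => by
    rw [← smul_eq_mul, ← map_smul, ← map_add]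
    simp
  have hepi' : ∀ (h : H) (r : ℝ), w + s * ‖h‖ < r → φ (h, 0) + r * φ (0, 1) < v :=
    fun h r hr => by
      rw [← hsplit]
      exact hlt _ hr
  have hgr : ∀ f ∈ F, ∀ g ∈ G, v ≤ φ (ι (g - f), 0) + T (g - f) * φ (0, 1) :=
    fun f hf g hg => by
      rw [← hsplit]
      exact hle _ ⟨g - f, Set.sub_mem_sub hg hf, rfl⟩
  have hv0 : v ≤ 0 := by
    obtain ⟨h₀, hF₀, hG₀⟩ := hFG
    simpa [← Prod.zero_eq_mk] using hgr h₀ hF₀ h₀ hG₀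
  -- The separating hyperplane is not vertical, as `epi` projects onto `H` and `0 ∈ graph`.
  have hκ : φ (0, 1) < 0 := by
    have h1 := hepi' 0 (|w| + 1) (by
      have := le_abs_self w
      simp only [norm_zero, mul_zero, add_zero]
      linarith)
    rw [← Prod.zero_eq_mk, map_zero, zero_add] at h1
    by_contra! hcon
    have : 0 ≤ (|w| + 1) * φ (0, 1) := by positivity
    linarith
  set κ : ℝ := -φ (0, 1) with hκd
  have hκ0 : 0 < κ := by linarith
  set ψ : H →L[ℝ] ℝ := κ⁻¹ • φ.comp (ContinuousLinearMap.inl ℝ H ℝ) with hψ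
  have hψa : ∀ h, φ (h, 0) = κ * ψ h := fun h => by
    simp [hψ, mul_inv_cancel_left₀ hκ0.ne']
  -- The upper bound holds up to an additive constant, which disappears by homogeneity.
  have hub : ∀ h, ψ h ≤ v / κ + w + s * ‖h‖ := fun h => by
    refine le_of_forall_pos_le_add fun δ hδ => ?_
    have h1 := hepi' h (w + s * ‖h‖ + δ) (by linarith)
    rw [hψa] at h1
    have h2 : κ * ψ h < κ * (v / κ + w + s * ‖h‖ + δ) := by
      have : κ * (v / κ) = v := mul_div_cancel₀ v hκ0.ne'
      nlinarith
    exact (lt_of_mul_lt_mul_left h2 hκ0.le).le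
  have hw' : -(v / κ) ≤ w := by
    have := hub 0
    simp only [map_zero, norm_zero, mul_zero, add_zero] at this
    linarith
  have hψs : ∀ h, ψ h ≤ s * ‖h‖ := fun h => by
    refine le_of_forall_pos_le_add fun δ hδ => ?_
    set K := v / κ + w with hK
    have hK0 : 0 ≤ K := by linarith
    have h1 := hub ((K / δ + 1) • h)
    rw [map_smul, norm_smul, Real.norm_of_nonneg (by positivity), smul_eq_mul] at h1
    have h2 : K ≤ (K / δ + 1) * δ := by
      rw [add_mul, div_mul_cancel₀ _ hδ.ne']
      linarith
    have h3 : (K / δ + 1) * ψ h ≤ (K / δ + 1) * (s * ‖h‖ + δ) := by linarith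
    exact le_of_mul_le_mul_left h3 (by positivity)
  refine ⟨(InnerProductSpace.toDual ℝ H).symm ψ, ?_, fun f hf g hg => ?_⟩
  · rw [LinearIsometryEquiv.norm_map]
    refine ψ.opNorm_le_bound hs fun h => abs_le.2 ⟨?_, hψs h⟩
    have := hψs (-h)
    rw [map_neg, norm_neg] at this
    linarith
  · rw [InnerProductSpace.toDual_symm_apply]
    have h1 := hgr f hf g hg
    rw [hψa] at h1
    have h2 : κ * T (g - f) ≤ κ * (ψ (ι (g - f)) - v / κ) := by
      have : κ * (v / κ) = v := mul_div_cancel₀ v hκ0.ne'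
      rw [mul_sub, this]
      have : T (g - f) * φ (0, 1) = -(κ * T (g - f)) := by
        rw [hκd]
        ring
      linarith
    have := le_of_mul_le_mul_left h2 hκ0
    linarith

/-- An affine functional `c + ⟪u, ι f⟫` which overestimates `T` by at most `w / 2` on `F` and
underestimates it by at most `w / 2` on `G`, with slope at most `w / ε`. -/
lemma exists_affine_approx [CompleteSpace H] {ι : V →ₗ[ℝ] H} {T : V →ₗ[ℝ] ℝ} {F G : Set V}
    (hF : Convex ℝ F) (hG : Convex ℝ G) (hFG : (F ∩ G).Nonempty) {w ε : ℝ} (hw : 0 ≤ w)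
    (hε : 0 < ε) (hmod : ∀ f ∈ F, ∀ g ∈ G, ‖ι (g - f)‖ ≤ ε → T g - T f ≤ w) :
    ∃ (c : ℝ) (u : H), ‖u‖ ≤ w / ε ∧ (∀ g ∈ G, -(w / 2) ≤ c + inner ℝ u (ι g) - T g) ∧
      ∀ f ∈ F, c + inner ℝ u (ι f) - T f ≤ w / 2 := by
  obtain ⟨u, hu, hsand⟩ := exists_inner_sandwich (ι := ι) (T := T) hF hG hFG (w := w)
    (s := w / ε) (by positivity)
    fun f hf g hg => sub_le_add_mul_norm hF hG hFG hw hε hmod hf hg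
  set A : Set ℝ := (fun g => T g - inner ℝ u (ι g)) '' G with hA
  have hAF : ∀ f ∈ F, ∀ x ∈ A, x ≤ w + (T f - inner ℝ u (ι f)) := by
    rintro f hf x ⟨g, hg, rfl⟩
    have := hsand f hf g hg
    rw [map_sub, map_sub, inner_sub_right] at this
    linarith
  obtain ⟨h₀, hF₀, hG₀⟩ := hFG
  have hAne : A.Nonempty := ⟨_, h₀, hG₀, rfl⟩
  have hAbdd : BddAbove A := ⟨_, hAF h₀ hF₀⟩
  refine ⟨sSup A - w / 2, u, hu, fun g hg => ?_, fun f hf => ?_⟩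
  · have := le_csSup hAbdd ⟨g, hg, rfl⟩
    simp only at this
    linarith
  · have := csSup_le hAne (hAF f hf)
    linarith

end Sandwich

/-! ### Admissible families of linear estimators -/

/-- A representation of a model with data laws `P` as a Gaussian shift experiment over the Hilbert
space `H`: the shift is `ι f = √n f`, measured in units of the noise. -/
structure IsShiftRepresentation (𝓜 : GaussianModel) {V : Submodule ℝ (𝓜.Index → ℝ)} {H : Type*}
    [NormedAddCommGroup H] [InnerProductSpace ℝ H] (P : V → Measure (𝓜.Index → ℝ)) (n : ℝ)
    (e : 𝓜.Index → H) (ι : V →ₗ[ℝ] H) : Prop where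
  shift : ∀ f, IsGaussianShift e (ι f) (P f)
  dense : Dense (Submodule.span ℝ (Set.range e) : Set H)
  norm_eq : ∀ f : V, ‖ι f‖ = √n * 𝓜.l2Norm f

namespace IsShiftRepresentation

variable {𝓜 : GaussianModel} {V : Submodule ℝ (𝓜.Index → ℝ)} {H : Type*}
  [NormedAddCommGroup H] [InnerProductSpace ℝ H] {P : V → Measure (𝓜.Index → ℝ)} {n : ℝ}
  {e : 𝓜.Index → H} {ι : V →ₗ[ℝ] H}

lemma l2Norm_le_iff (h : IsShiftRepresentation 𝓜 P n e ι) (hn : 0 < n) (z : ℝ) (f : V) :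
    𝓜.l2Norm f ≤ z / √n ↔ ‖ι f‖ ≤ z := by
  rw [h.norm_eq, le_div_iff₀ (Real.sqrt_pos.2 hn), mul_comm]

lemma orderedModulus_le_iff (h : IsShiftRepresentation 𝓜 P n e ι) (hn : 0 < n) {T : V →ₗ[ℝ] ℝ}
    {z w : ℝ} {F G : Set V} :
    𝓜.orderedModulus T (z / √n) F G ≤ (w : EReal) ↔
      ∀ f ∈ F, ∀ g ∈ G, ‖ι (g - f)‖ ≤ z → T g - T f ≤ w := by
  simp only [GaussianModel.orderedModulus, iSup_le_iff, EReal.coe_le_coe_iff,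
    h.l2Norm_le_iff hn]

lemma orderedModulus_nonneg (h : IsShiftRepresentation 𝓜 P n e ι) (hn : 0 < n) (T : V →ₗ[ℝ] ℝ)
    {z : ℝ} (hz : 0 ≤ z) {F G : Set V} (hFG : (F ∩ G).Nonempty) :
    0 ≤ 𝓜.orderedModulus T (z / √n) F G := by
  obtain ⟨h₀, hF, hG⟩ := hFG
  have h1 : 𝓜.l2Norm ((h₀ - h₀ : V) : 𝓜.Index → ℝ) ≤ z / √n := by
    rw [h.l2Norm_le_iff hn, sub_self, map_zero, norm_zero]
    exact hz
  have h2 : ((T h₀ - T h₀ : ℝ) : EReal) ≤ 𝓜.orderedModulus T (z / √n) F G :=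
    le_iSup₂_of_le h₀ hF (le_iSup₂_of_le h₀ hG (le_iSup_of_le h1 le_rfl))
  simpa using h2

/-- The Wiener integral `c + ∫ u dY` as a linear estimator. -/
lemma exists_isLinearEstimator (h : IsShiftRepresentation 𝓜 P n e ι) (c : ℝ) (u : H) :
    ∃ S, 𝓜.IsLinearEstimator P S ∧
      ∀ f, HasLaw S (gaussianReal (c + inner ℝ u (ι f)) (‖u‖₊ ^ 2)) (P f) := by
  obtain ⟨S, a, hS, ha, hlim⟩ := exists_wienerIntegral (h.dense u)
  have hlim' : ∀ f, IsMeanSquareLimit (P f) c a fun y => c + S y := fun f => by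
    refine (hlim _ _ (h.shift f)).congr fun m => ?_
    congr 1
    ext y
    ring
  refine ⟨fun y => c + S y, ⟨hS.const_add c, c, a, hlim'⟩, fun f => ?_⟩
  exact (h.shift f).hasLaw_of_isMeanSquareLimit (hS.const_add c) (hlim' f) ha

/-- A linear estimator is Gaussian under every `P f`. -/
lemma hasLaw_of_isLinearEstimator [CompleteSpace H] (h : IsShiftRepresentation 𝓜 P n e ι)
    {S : (𝓜.Index → ℝ) → ℝ} (hS : 𝓜.IsLinearEstimator P S) (f : V) :
    HasLaw S (gaussianReal (∫ y, S y ∂(P f)) (Var[S; P f]).toNNReal) (P f) := by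
  obtain ⟨hSm, c, a, hlim⟩ := hS
  obtain ⟨u, hu⟩ := (h.shift f).exists_tendsto_of_isMeanSquareLimit hSm (hlim f)
  have hlaw := (h.shift f).hasLaw_of_isMeanSquareLimit hSm (hlim f) hu
  rw [hlaw.integral_eq, integral_id_gaussianReal, hlaw.variance_eq, variance_id_gaussianReal,
    Real.toNNReal_coe]
  exact hlaw

/-- For each pair `(i, j)` with finite modulus the affine functional of `exists_affine_approx` is
estimated without bias by its Wiener integral; an infinite modulus imposes no requirement. -/
lemma exists_isEstimatorFamily [CompleteSpace H] (h : IsShiftRepresentation 𝓜 P n e ι)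
    (hn : 0 < n) (T : V →ₗ[ℝ] ℝ) {k : ℕ} {F : Fin k → Set V} (hconv : ∀ j, Convex ℝ (F j))
    (hinter : ∀ i j, (F i ∩ F j).Nonempty) {β : ℝ} (hz : 0 < zQuantile (β / 2)) :
    ∃ S, 𝓜.IsEstimatorFamily P n T F β S := by
  set z := zQuantile (β / 2) with hzd
  have hex : ∀ i j, ∃ S : (𝓜.Index → ℝ) → ℝ, 𝓜.IsLinearEstimator P S ∧
      (∀ f : V, ((Var[S; P f] : ℝ) : EReal) ≤
        ((1 / z ^ 2 : ℝ) : EReal) * 𝓜.orderedModulus T (z / √n) (F i) (F j) ^ 2) ∧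
      (∀ f ∈ F j, -(((1 / 2 : ℝ) : EReal) * 𝓜.orderedModulus T (z / √n) (F i) (F j)) ≤
        ((∫ y, S y ∂(P f) - T f : ℝ) : EReal)) ∧
      ∀ f ∈ F i, ((∫ y, S y ∂(P f) - T f : ℝ) : EReal) ≤
        ((1 / 2 : ℝ) : EReal) * 𝓜.orderedModulus T (z / √n) (F i) (F j) := by
    intro i j
    have hnn := h.orderedModulus_nonneg hn T hz.le (hinter i j)
    generalize hω : 𝓜.orderedModulus T (z / √n) (F i) (F j) = ω at hnn
    induction ω with
    | bot => simp at hnn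
    | top =>
      obtain ⟨S, hS, -⟩ := h.exists_isLinearEstimator 0 0
      have h1 : ((1 / z ^ 2 : ℝ) : EReal) * ⊤ ^ 2 = ⊤ := by
        rw [pow_two (⊤ : EReal), EReal.top_mul_top, EReal.coe_mul_top_of_pos (by positivity)]
      have h2 : ((1 / 2 : ℝ) : EReal) * ⊤ = ⊤ := EReal.coe_mul_top_of_pos (by norm_num)
      rw [h1, h2, EReal.neg_top]
      exact ⟨S, hS, fun _ => le_top, fun _ _ => bot_le, fun _ _ => le_top⟩
    | coe w =>
      have hw : 0 ≤ w := EReal.coe_nonneg.1 hnn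
      obtain ⟨c, u, hu, hG, hF⟩ := exists_affine_approx (hconv i) (hconv j) (hinter i j) hw hz
        ((h.orderedModulus_le_iff hn).1 hω.le)
      obtain ⟨S, hS, hlaw⟩ := h.exists_isLinearEstimator c u
      have hmean : ∀ f, ∫ y, S y ∂(P f) = c + inner ℝ u (ι f) := fun f => by
        rw [(hlaw f).integral_eq, integral_id_gaussianReal]
      refine ⟨S, hS, fun f => ?_, fun f hf => ?_, fun f hf => ?_⟩
      · rw [(hlaw f).variance_eq, variance_id_gaussianReal, ← EReal.coe_pow, ← EReal.coe_mul,
          EReal.coe_le_coe_iff]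
        push_cast
        calc ‖u‖ ^ 2 ≤ (w / z) ^ 2 := by gcongr
          _ = 1 / z ^ 2 * w ^ 2 := by ring
      · rw [← EReal.coe_mul, ← EReal.coe_neg, EReal.coe_le_coe_iff, hmean]
        linarith [hG f hf]
      · rw [← EReal.coe_mul, EReal.coe_le_coe_iff, hmean]
        linarith [hF f hf]
  choose S hS using hex
  exact ⟨S, fun i j => (hS i j).1, fun i j => (hS i j).2.1, fun i j => (hS i j).2.2.1,
    fun i j => (hS i j).2.2.2⟩

end IsShiftRepresentation

/-! ### Tails and excesses of Gaussian estimators -/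

lemma hasLaw_gaussianReal_std (m : ℝ) (v : ℝ≥0) :
    HasLaw (fun x : ℝ => m + √v * x) (gaussianReal m v) (gaussianReal 0 1) := by
  have h2 := gaussianReal_const_add (gaussianReal_const_mul
    (HasLaw.id (μ := gaussianReal 0 1)) √v) m
  have h3 : v = NNReal.mk (√v ^ 2) (sq_nonneg √v) * 1 := NNReal.eq (by simp)
  rw [mul_zero, zero_add, ← h3] at h2
  exact h2

section Tails

variable {Ω : Type*} [MeasurableSpace Ω] {Q : Measure Ω} {X : Ω → ℝ} {m t w : ℝ} {v : ℝ≥0} {β : ℝ}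

lemma sqrt_mul_le_of_le {z : ℝ} (hz : 0 < z) (hw : 0 ≤ w) (hv : (v : ℝ) ≤ 1 / z ^ 2 * w ^ 2) :
    √v * z ≤ w := by
  rw [← le_div_iff₀ hz]
  refine Real.sqrt_le_iff.2 ⟨by positivity, hv.trans_eq ?_⟩
  ring

/-- An estimator with standard deviation at most `w / z_β` and bias at most `w / 2` exceeds its
target by more than `3 w / 2` with probability at most `β`. -/
lemma measure_lt_sub_le (hX : HasLaw X (gaussianReal m v) Q) (h0 : 0 < β) (h1 : β < 1 / 2)
    (hw : 0 ≤ w) (hv : (v : ℝ) ≤ 1 / zQuantile β ^ 2 * w ^ 2) (hm : m - t ≤ 1 / 2 * w) :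
    Q {ω | t < X ω - 3 / 2 * w} ≤ ENNReal.ofReal β := by
  have hz := zQuantile_pos h0 h1
  have hσ := sqrt_mul_le_of_le hz hw hv
  have hmeas : MeasurableSet {x : ℝ | t < x - 3 / 2 * w} :=
    measurableSet_lt measurable_const (by fun_prop)
  rw [hX.measure_eq hmeas, ← (hasLaw_gaussianReal_std m v).measure_eq hmeas,
    ← gaussianReal_Ioi_zQuantile h0 (by linarith)]
  refine measure_mono fun x hx => ?_
  rw [Set.mem_ofPred_eq] at hx
  rw [Set.mem_Ioi]
  by_contra! hxz
  have := mul_le_mul_of_nonneg_left hxz (Real.sqrt_nonneg v)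
  linarith

lemma measure_add_lt_le (hX : HasLaw X (gaussianReal m v) Q) (h0 : 0 < β) (h1 : β < 1 / 2)
    (hw : 0 ≤ w) (hv : (v : ℝ) ≤ 1 / zQuantile β ^ 2 * w ^ 2) (hm : -(1 / 2 * w) ≤ m - t) :
    Q {ω | X ω + 3 / 2 * w < t} ≤ ENNReal.ofReal β := by
  have h := measure_lt_sub_le (gaussianReal_neg hX) (t := -t) h0 h1 hw hv (by linarith)
  refine (measure_mono fun ω hω => ?_).trans h
  rw [Set.mem_ofPred_eq] at hω ⊢
  rw [Pi.neg_apply]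
  linarith

/-- The expected overshoot of `X + 3 w / 2` above `t + 3 M`, for `w ≤ M`. -/
lemma lintegral_add_excess_le (hX : HasLaw X (gaussianReal m v) Q) (h0 : 0 < β) (h1 : β < 1 / 2)
    (hw : 0 ≤ w) (hv : (v : ℝ) ≤ 1 / zQuantile β ^ 2 * w ^ 2) (hm : m - t ≤ 1 / 2 * w) {M : ℝ}
    (hM : w ≤ M) :
    ∫⁻ ω, ENNReal.ofReal (X ω + 3 / 2 * w - t - 3 * M) ∂Q ≤
      ENNReal.ofReal (M / zQuantile β * (β / zQuantile β)) := by
  have hz := zQuantile_pos h0 h1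
  set z := zQuantile β with hzd
  have hσ : √v ≤ M / z := by
    rw [le_div_iff₀ hz]
    exact (sqrt_mul_le_of_le hz hw hv).trans hM
  have hM0 : 0 ≤ M := hw.trans hM
  rw [hX.lintegral_comp (f := fun x => ENNReal.ofReal (x + 3 / 2 * w - t - 3 * M)) (by fun_prop),
    ← (hasLaw_gaussianReal_std m v).lintegral_comp (by fun_prop)]
  calc ∫⁻ x, ENNReal.ofReal (m + √v * x + 3 / 2 * w - t - 3 * M) ∂(gaussianReal 0 1)
      ≤ ∫⁻ x, ENNReal.ofReal (M / z) * ENNReal.ofReal (x - z) ∂(gaussianReal 0 1) := by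
        refine lintegral_mono fun x => ?_
        rw [← ENNReal.ofReal_mul (by positivity)]
        rcases le_or_gt x 0 with hx | hx
        · rw [ENNReal.ofReal_of_nonpos]
          · exact zero_le
          · have := mul_nonpos_of_nonneg_of_nonpos (Real.sqrt_nonneg v) hx
            linarith
        · refine ENNReal.ofReal_le_ofReal ?_
          have h3 := mul_le_mul_of_nonneg_right hσ hx.le
          rw [mul_sub, div_mul_cancel₀ _ hz.ne']
          linarith
    _ ≤ ENNReal.ofReal (M / z) * (ENNReal.ofReal (1 / z) * gaussianReal 0 1 (Set.Ioi z)) := by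
        rw [lintegral_const_mul _ (by fun_prop)]
        gcongr
        exact lintegral_gaussian_excess_le hz
    _ = _ := by
        rw [hzd, gaussianReal_Ioi_zQuantile h0 (by linarith), ← ENNReal.ofReal_mul (by positivity),
          ← ENNReal.ofReal_mul (by positivity)]
        congr 1
        ring

lemma lintegral_sub_excess_le (hX : HasLaw X (gaussianReal m v) Q) (h0 : 0 < β) (h1 : β < 1 / 2)
    (hw : 0 ≤ w) (hv : (v : ℝ) ≤ 1 / zQuantile β ^ 2 * w ^ 2) (hm : -(1 / 2 * w) ≤ m - t) {M : ℝ}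
    (hM : w ≤ M) :
    ∫⁻ ω, ENNReal.ofReal (t - 3 * M - (X ω - 3 / 2 * w)) ∂Q ≤
      ENNReal.ofReal (M / zQuantile β * (β / zQuantile β)) := by
  have h := lintegral_add_excess_le (gaussianReal_neg hX) (t := -t) h0 h1 hw hv (by linarith) hM
  refine (lintegral_mono fun ω => ENNReal.ofReal_le_ofReal ?_).trans h
  rw [Pi.neg_apply]
  linarith

end Tails

/-! ### Coverage and expected length of the Bonferroni interval -/

/-- The bounds on variance and bias of an admissible family, for a pair with finite modulus. -/
lemma GaussianModel.IsEstimatorFamily.bounds_of_eq_coe {𝓜 : GaussianModel}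
    {V : Submodule ℝ (𝓜.Index → ℝ)} {k : ℕ} {P : V → Measure (𝓜.Index → ℝ)} {n : ℝ}
    {T : V →ₗ[ℝ] ℝ} {F : Fin k → Set V} {β : ℝ} {S : Fin k → Fin k → (𝓜.Index → ℝ) → ℝ}
    (hS : 𝓜.IsEstimatorFamily P n T F β S) {i j : Fin k} {w : ℝ}
    (hw : 𝓜.orderedModulus T (zQuantile (β / 2) / √n) (F i) (F j) = w) :
    (∀ f, ((Var[S i j; P f]).toNNReal : ℝ) ≤ 1 / zQuantile (β / 2) ^ 2 * w ^ 2) ∧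
      (∀ f ∈ F j, -(1 / 2 * w) ≤ ∫ y, S i j y ∂(P f) - T f) ∧
      ∀ f ∈ F i, ∫ y, S i j y ∂(P f) - T f ≤ 1 / 2 * w := by
  refine ⟨fun f => ?_, fun f hf => ?_, fun f hf => ?_⟩
  · have := hS.variance_le i j f
    rw [hw, ← EReal.coe_pow, ← EReal.coe_mul, EReal.coe_le_coe_iff] at this
    rwa [Real.coe_toNNReal _ (variance_nonneg _ _)]
  · have := hS.le_bias i j f hf
    rwa [hw, ← EReal.coe_mul, ← EReal.coe_neg, EReal.coe_le_coe_iff] at this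
  · have := hS.bias_le i j f hf
    rwa [hw, ← EReal.coe_mul, EReal.coe_le_coe_iff] at this

lemma isRandomInterval_bonferroniInterval {𝓜 : GaussianModel} {V : Submodule ℝ (𝓜.Index → ℝ)}
    {k : ℕ} {S : Fin k → Fin k → (𝓜.Index → ℝ) → ℝ} (hS : ∀ i j, Measurable (S i j)) (n : ℝ)
    (T : V →ₗ[ℝ] ℝ) (F : Fin k → Set V) (α : ℝ) :
    IsRandomInterval (𝓜.bonferroniInterval n T F α S) := by
  set ω := fun i j => ((3 / 2 : ℝ) : EReal) *
    𝓜.orderedModulus T (zQuantile (α / k / 2) / √n) (F i) (F j)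
  refine ⟨fun y => ⨆ j, ⨅ i, ((S i j y : EReal) - ω i j),
    fun y => ⨅ j, ⨆ i, ((S j i y : EReal) + ω j i), ?_, ?_, fun y => ?_⟩
  · simp_rw [sub_eq_add_neg]
    exact Measurable.iSup fun j => Measurable.iInf fun i => (hS i j).coe_real_ereal.add_const _
  · exact Measurable.iInf fun j => Measurable.iSup fun i => (hS j i).coe_real_ereal.add_const _
  · ext x
    simp only [GaussianModel.bonferroniInterval, GaussianModel.starInterval, Set.mem_iInter,
      Set.mem_ofPred_eq, iSup_le_iff, le_iInf_iff, forall_and]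
    rfl

namespace IsShiftRepresentation

variable {𝓜 : GaussianModel} {V : Submodule ℝ (𝓜.Index → ℝ)} {H : Type*}
  [NormedAddCommGroup H] [InnerProductSpace ℝ H]
  {P : V → Measure (𝓜.Index → ℝ)} {n : ℝ} {e : 𝓜.Index → H} {ι : V →ₗ[ℝ] H}
  {T : V →ₗ[ℝ] ℝ} {k : ℕ} {F : Fin k → Set V} {α : ℝ}
  {S : Fin k → Fin k → (𝓜.Index → ℝ) → ℝ}

/-- The lower endpoint built from `S i j` exceeds `T f` with probability at most `β / 2` for
`f ∈ F i`, and the upper endpoint built from `S i j` falls below `T f` with probability at most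
`β / 2` for `f ∈ F j`. An infinite modulus makes the endpoints infinite. -/
lemma measure_endpoint_le [CompleteSpace H] (h : IsShiftRepresentation 𝓜 P n e ι) (hn : 0 < n)
    (hinter : ∀ i j, (F i ∩ F j).Nonempty) {β : ℝ} (h0 : 0 < β / 2) (h1 : β / 2 < 1 / 2)
    (hS : 𝓜.IsEstimatorFamily P n T F β S) (i j : Fin k) {f : V} :
    (f ∈ F i → P f {y | ¬ ((S i j y : EReal) - ((3 / 2 : ℝ) : EReal) *
      𝓜.orderedModulus T (zQuantile (β / 2) / √n) (F i) (F j) ≤ (T f : EReal))} ≤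
        ENNReal.ofReal (β / 2)) ∧
    (f ∈ F j → P f {y | ¬ ((T f : EReal) ≤ (S i j y : EReal) + ((3 / 2 : ℝ) : EReal) *
      𝓜.orderedModulus T (zQuantile (β / 2) / √n) (F i) (F j))} ≤ ENNReal.ofReal (β / 2)) := by
  have hz := zQuantile_pos h0 h1
  have hnn := h.orderedModulus_nonneg hn T hz.le (hinter i j)
  have hlaw := h.hasLaw_of_isLinearEstimator (hS.linear i j) f
  generalize hω : 𝓜.orderedModulus T (zQuantile (β / 2) / √n) (F i) (F j) = ω at hnn
  induction ω with
  | bot => simp at hnn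
  | top =>
    have h2 : ((3 / 2 : ℝ) : EReal) * ⊤ = ⊤ := EReal.coe_mul_top_of_pos (by norm_num)
    simp only [h2, EReal.sub_top, bot_le, EReal.coe_add_top, le_top, not_true_eq_false]
    simp
  | coe w =>
    obtain ⟨hvar, hle, hge⟩ := hS.bounds_of_eq_coe hω
    have hw : 0 ≤ w := EReal.coe_nonneg.1 hnn
    constructor
    · intro hf
      refine (measure_mono fun y hy => ?_).trans
        (measure_lt_sub_le hlaw h0 h1 hw (hvar f) (hge f hf))
      rw [Set.mem_ofPred_eq, ← EReal.coe_mul, ← EReal.coe_sub, EReal.coe_le_coe_iff] at hy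
      exact not_le.1 hy
    · intro hf
      refine (measure_mono fun y hy => ?_).trans
        (measure_add_lt_le hlaw h0 h1 hw (hvar f) (hle f hf))
      rw [Set.mem_ofPred_eq, ← EReal.coe_mul, ← EReal.coe_add, EReal.coe_le_coe_iff] at hy
      exact not_le.1 hy

/-- For `f ∈ F j`, the interval can miss `T f` only if one of the `2 k` endpoints built from the
estimators `S j l` and `S l j` does. -/
lemma bonferroniInterval_mem_confidenceIntervals [CompleteSpace H]
    (h : IsShiftRepresentation 𝓜 P n e ι) (hn : 0 < n) (hk : 1 ≤ k)
    (hinter : ∀ i j, (F i ∩ F j).Nonempty) (hα : 0 < α)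
    (hα' : α < 1 / 2) (hS : 𝓜.IsEstimatorFamily P n T F (α / k) S) :
    𝓜.bonferroniInterval n T F α S ∈ confidenceIntervals P T α (⋃ j, F j) := by
  have hCI := isRandomInterval_bonferroniInterval (fun i j => (hS.linear i j).1) n T F α
  refine ⟨hCI, fun f hf => ?_⟩
  obtain ⟨j, hj⟩ := Set.mem_iUnion.1 hf
  have := (h.shift f).isProbabilityMeasure
  have hk0 : (1 : ℝ) ≤ k := by exact_mod_cast hk
  have hβ0 : 0 < α / k / 2 := by positivity
  have hβ1 : α / k / 2 < 1 / 2 := by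
    have : α / k ≤ α := div_le_self hα.le hk0
    linarith
  have hmeas := measurableSet_mem_of_isRandomInterval hCI (T f)
  set A := {y | T f ∈ 𝓜.bonferroniInterval n T F α S y} with hA
  have hsub : Aᶜ ⊆ ⋃ l : Fin k,
      ({y | ¬ ((S j l y : EReal) - ((3 / 2 : ℝ) : EReal) *
        𝓜.orderedModulus T (zQuantile (α / k / 2) / √n) (F j) (F l) ≤ (T f : EReal))} ∪
      {y | ¬ ((T f : EReal) ≤ (S l j y : EReal) + ((3 / 2 : ℝ) : EReal) *
        𝓜.orderedModulus T (zQuantile (α / k / 2) / √n) (F l) (F j))}) := by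
    intro y hy
    by_contra hcon
    simp only [Set.mem_iUnion, Set.mem_union, Set.mem_ofPred_eq, not_exists, not_or, not_not]
      at hcon
    refine hy ?_
    rw [hA, Set.mem_ofPred_eq, GaussianModel.bonferroniInterval, Set.mem_iInter]
    intro l
    exact ⟨iInf_le_of_le j (hcon l).1, le_iSup_of_le j (hcon l).2⟩
  have hbad : P f Aᶜ ≤ ENNReal.ofReal α := by
    calc P f Aᶜ ≤ ∑ l : Fin k, (ENNReal.ofReal (α / k / 2) + ENNReal.ofReal (α / k / 2)) := by
          refine (measure_mono hsub).trans ((measure_iUnion_fintype_le _ _).trans ?_)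
          refine Finset.sum_le_sum fun l _ => (measure_union_le _ _).trans ?_
          exact add_le_add ((h.measure_endpoint_le hn hinter hβ0 hβ1 hS j l).1 hj)
            ((h.measure_endpoint_le hn hinter hβ0 hβ1 hS l j).2 hj)
      _ = ENNReal.ofReal α := by
          rw [Finset.sum_const, Finset.card_univ, Fintype.card_fin,
            ← ENNReal.ofReal_add hβ0.le hβ0.le, ← ENNReal.ofReal_nsmul, nsmul_eq_mul]
          congr 1
          field_simp
          norm_num
  rw [ENNReal.ofReal_sub _ hα.le, ENNReal.ofReal_one, tsub_le_iff_right,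
    ← prob_add_prob_compl (μ := P f) hmeas]
  gcongr

/-- If all moduli involving `F j` are at most `M`, the expected length over `F j` is at most `8 M`:
either endpoint is within `3 M` of `T f` up to an overshoot of the largest of `k` noise terms, whose
expectation is at most `k (M / z) (α / (2 k z)) ≤ M`, where `z = z_{α / 2k} ≥ 1 / 2`. -/
lemma maxExpectedLength_bonferroniInterval_le [CompleteSpace H]
    (h : IsShiftRepresentation 𝓜 P n e ι) (hn : 0 < n) (hk : 1 ≤ k)
    (hinter : ∀ i j, (F i ∩ F j).Nonempty) (hα : 0 < α) (hα' : α < 1 / 2)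
    (hS : 𝓜.IsEstimatorFamily P n T F (α / k) S) (j : Fin k) {M : ℝ}
    (hM₁ : ∀ i, 𝓜.orderedModulus T (zQuantile (α / k / 2) / √n) (F i) (F j) ≤ (M : EReal))
    (hM₂ : ∀ i, 𝓜.orderedModulus T (zQuantile (α / k / 2) / √n) (F j) (F i) ≤ (M : EReal)) :
    maxExpectedLength P (𝓜.bonferroniInterval n T F α S) (F j) ≤ ENNReal.ofReal (8 * M) := by
  have hk0 : (1 : ℝ) ≤ k := by exact_mod_cast hk
  have hβ0 : 0 < α / k / 2 := by positivity
  have hβα : α / k ≤ α := div_le_self hα.le hk0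
  have hβ1 : α / k / 2 < 1 / 2 := by linarith
  have hz := half_le_zQuantile hβ0 (by linarith)
  set β := α / k / 2 with hβ
  set z := zQuantile β with hzd
  have hz0 : 0 < z := by linarith
  have hreal : ∀ i l, 𝓜.orderedModulus T (z / √n) (F i) (F l) ≤ (M : EReal) →
      ∃ w : ℝ, 0 ≤ w ∧ w ≤ M ∧ 𝓜.orderedModulus T (z / √n) (F i) (F l) = (w : EReal) := by
    intro i l hle
    have hnn := h.orderedModulus_nonneg hn T hz0.le (hinter i l)
    generalize 𝓜.orderedModulus T (z / √n) (F i) (F l) = ω at hle hnn ⊢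
    induction ω with
    | bot => simp at hnn
    | top => simp at hle
    | coe w => exact ⟨w, EReal.coe_nonneg.1 hnn, EReal.coe_le_coe_iff.1 hle, rfl⟩
  choose w₁ hw₁0 hw₁M hw₁ using fun i => hreal i j (hM₁ i)
  choose w₂ hw₂0 hw₂M hw₂ using fun i => hreal j i (hM₂ i)
  have hM0 : 0 ≤ M := (hw₁0 j).trans (hw₁M j)
  refine iSup₂_le fun f hf => ?_
  have := (h.shift f).isProbabilityMeasure
  set lower : Fin k → (𝓜.Index → ℝ) → ℝ≥0∞ :=
    fun i y => ENNReal.ofReal (T f - 3 * M - (S i j y - 3 / 2 * w₁ i)) with hlower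
  set upper : Fin k → (𝓜.Index → ℝ) → ℝ≥0∞ :=
    fun i y => ENNReal.ofReal (S j i y + 3 / 2 * w₂ i - T f - 3 * M) with hupper
  have hSm : ∀ i l, Measurable (S i l) := fun i l => (hS.linear i l).1
  have hlm : ∀ i, Measurable (lower i) := fun i => by
    have := hSm i j
    fun_prop
  have hum : ∀ i, Measurable (upper i) := fun i => by
    have := hSm j i
    fun_prop
  have hvol : ∀ y, volume (𝓜.bonferroniInterval n T F α S y) ≤
      ENNReal.ofReal (6 * M) + (∑ i, lower i y + ∑ i, upper i y) := by
    intro y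
    set A := ∑ i, max (T f - 3 * M - (S i j y - 3 / 2 * w₁ i)) 0 with hA
    set B := ∑ i, max (S j i y + 3 / 2 * w₂ i - T f - 3 * M) 0 with hB
    have hA0 : 0 ≤ A := Finset.sum_nonneg fun i _ => le_max_right _ _
    have hB0 : 0 ≤ B := Finset.sum_nonneg fun i _ => le_max_right _ _
    have hsub : 𝓜.bonferroniInterval n T F α S y ⊆
        Set.Icc (T f - 3 * M - A) (T f + 3 * M + B) := by
      intro x hx
      have hxj := Set.mem_iInter.1 hx j
      rw [GaussianModel.starInterval, Set.mem_ofPred_eq, ← hβ, ← hzd] at hxj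
      constructor
      · rw [← EReal.coe_le_coe_iff]
        refine le_trans (le_iInf fun i => ?_) hxj.1
        rw [hw₁ i, ← EReal.coe_mul, ← EReal.coe_sub, EReal.coe_le_coe_iff]
        have h1 := Finset.single_le_sum
          (f := fun i => max (T f - 3 * M - (S i j y - 3 / 2 * w₁ i)) 0)
          (fun i _ => le_max_right _ _) (Finset.mem_univ i)
        have h2 := le_max_left (T f - 3 * M - (S i j y - 3 / 2 * w₁ i)) 0
        linarith
      · rw [← EReal.coe_le_coe_iff]
        refine hxj.2.trans (iSup_le fun i => ?_)
        rw [hw₂ i, ← EReal.coe_mul, ← EReal.coe_add, EReal.coe_le_coe_iff]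
        have h1 := Finset.single_le_sum
          (f := fun i => max (S j i y + 3 / 2 * w₂ i - T f - 3 * M) 0)
          (fun i _ => le_max_right _ _) (Finset.mem_univ i)
        have h2 := le_max_left (S j i y + 3 / 2 * w₂ i - T f - 3 * M) 0
        linarith
    have hmax : ∀ x : ℝ, ENNReal.ofReal (max x 0) = ENNReal.ofReal x := fun x => by
      rw [ENNReal.ofReal_max, ENNReal.ofReal_zero, max_eq_left zero_le]
    calc volume (𝓜.bonferroniInterval n T F α S y)
        ≤ ENNReal.ofReal (T f + 3 * M + B - (T f - 3 * M - A)) := by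
          rw [← Real.volume_Icc]
          exact measure_mono hsub
      _ = ENNReal.ofReal (6 * M + (A + B)) := by
          congr 1
          ring
      _ = _ := by
          rw [ENNReal.ofReal_add (by positivity) (by positivity), ENNReal.ofReal_add hA0 hB0, hA,
            hB, ENNReal.ofReal_sum_of_nonneg fun i _ => le_max_right _ _,
            ENNReal.ofReal_sum_of_nonneg fun i _ => le_max_right _ _]
          simp_rw [hmax]
          rfl
  set ε : ℝ := M / z * (β / z) with hε
  have hε0 : 0 ≤ ε := by positivity
  have hlow : ∀ i, ∫⁻ y, lower i y ∂(P f) ≤ ENNReal.ofReal ε := fun i => by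
    obtain ⟨hvar, hle, -⟩ := hS.bounds_of_eq_coe (hw₁ i)
    exact lintegral_sub_excess_le (h.hasLaw_of_isLinearEstimator (hS.linear i j) f) hβ0 hβ1
      (hw₁0 i) (hvar f) (hle f hf) (hw₁M i)
  have hupp : ∀ i, ∫⁻ y, upper i y ∂(P f) ≤ ENNReal.ofReal ε := fun i => by
    obtain ⟨hvar, -, hge⟩ := hS.bounds_of_eq_coe (hw₂ i)
    exact lintegral_add_excess_le (h.hasLaw_of_isLinearEstimator (hS.linear j i) f) hβ0 hβ1
      (hw₂0 i) (hvar f) (hge f hf) (hw₂M i)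
  have hkε : k * ε ≤ M := by
    have h1 : k * ε = M * (α / 2) / z ^ 2 := by
      rw [hε, hβ]
      field_simp
    rw [h1, div_le_iff₀ (by positivity)]
    have : (1 / 4 : ℝ) ≤ z ^ 2 := by nlinarith
    nlinarith
  calc ∫⁻ y, volume (𝓜.bonferroniInterval n T F α S y) ∂(P f)
      ≤ ∫⁻ y, (ENNReal.ofReal (6 * M) + (∑ i, lower i y + ∑ i, upper i y)) ∂(P f) :=
        lintegral_mono hvol
    _ = ENNReal.ofReal (6 * M) + (∑ i, ∫⁻ y, lower i y ∂(P f) + ∑ i, ∫⁻ y, upper i y ∂(P f)) := by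
        rw [lintegral_add_left measurable_const, lintegral_const, measure_univ, mul_one,
          lintegral_add_left (Finset.measurable_sum _ fun i _ => hlm i),
          lintegral_finsetSum _ fun i _ => hlm i, lintegral_finsetSum _ fun i _ => hum i]
    _ ≤ ENNReal.ofReal (6 * M) +
        (∑ _ : Fin k, ENNReal.ofReal ε + ∑ _ : Fin k, ENNReal.ofReal ε) := by
        gcongr with i _ i _
        · exact hlow i
        · exact hupp i
    _ = ENNReal.ofReal (6 * M + (k * ε + k * ε)) := by
        rw [Finset.sum_const, Finset.card_univ, Fintype.card_fin, ← ENNReal.ofReal_nsmul,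
          nsmul_eq_mul, ENNReal.ofReal_add (by positivity) (by positivity),
          ENNReal.ofReal_add (by positivity) (by positivity)]
    _ ≤ ENNReal.ofReal (8 * M) := ENNReal.ofReal_le_ofReal (by linarith)

/-- The two-point bound, applied after shrinking a pair at distance `z` to one at distance `z_α`. -/
lemma ofReal_le_optimalLength (h : IsShiftRepresentation 𝓜 P n e ι)
    (hconv : ∀ j, Convex ℝ (F j)) (hinter : ∀ i j, (F i ∩ F j).Nonempty) (hα : 0 < α)
    (hα' : α < 1 / 2) {z : ℝ} (hz : zQuantile α ≤ z) {i j : Fin k} {f g : V} (hf : f ∈ F j)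
    (hg : g ∈ F i) (hfg : ‖ι (g - f)‖ ≤ z) :
    ENNReal.ofReal ((1 / 2 - α) * (zQuantile α / z * |T g - T f|)) ≤
      optimalLength P T α (F j) (⋃ i, F i) := by
  have hzα := zQuantile_pos hα hα'
  have hz0 : 0 < z := hzα.trans_le hz
  obtain ⟨f', hf', g', hg', heq⟩ := exists_sub_eq_smul_sub (hconv j) (hconv i) (hinter j i) hf hg
    (r := zQuantile α / z) (by positivity) ((div_le_one hz0).2 hz)
  refine le_iInf₂ fun C hC => ?_
  have h1 := le_lintegral_volume_of_mem_confidenceIntervals h.shift h.dense hα hα' hC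
    (Set.mem_iUnion_of_mem j hf') (Set.mem_iUnion_of_mem i hg') (by
      rw [← map_sub, heq, map_smul, norm_smul, Real.norm_of_nonneg (by positivity),
        div_mul_eq_mul_div, div_le_iff₀ hz0]
      exact mul_le_mul_of_nonneg_left hfg hzα.le)
  rw [← map_sub T g', heq, map_smul, smul_eq_mul, abs_mul, abs_of_nonneg (by positivity),
    map_sub] at h1
  exact h1.trans (le_iSup₂ (f := fun f (_ : f ∈ F j) => ∫⁻ y, volume (C y) ∂(P f)) f' hf')

/-- If `L*_α(F j, ⋃ F i)` is finite, the moduli involving `F j` are at most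
`M = z_{α / 2k} / ((1 / 2 - α) z_α) L*_α`, and the expected length is at most `8 M ≤ 12 M`. -/
lemma maxExpectedLength_le_mul_optimalLength [CompleteSpace H]
    (h : IsShiftRepresentation 𝓜 P n e ι) (hn : 0 < n) (hk : 1 ≤ k)
    (hconv : ∀ j, Convex ℝ (F j)) (hinter : ∀ i j, (F i ∩ F j).Nonempty)
    (hα : 0 < α) (hα' : α < 1 / 2) (hS : 𝓜.IsEstimatorFamily P n T F (α / k) S) (j : Fin k) :
    maxExpectedLength P (𝓜.bonferroniInterval n T F α S) (F j) ≤
      ENNReal.ofReal (12 * zQuantile (α / k / 2) / ((1 / 2 - α) * zQuantile α)) *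
        optimalLength P T α (F j) (⋃ i, F i) := by
  have hk0 : (1 : ℝ) ≤ k := by exact_mod_cast hk
  have hβ0 : 0 < α / k / 2 := by positivity
  have hβα : α / k ≤ α := div_le_self hα.le hk0
  have hzα := zQuantile_pos hα hα'
  have hzz : zQuantile α ≤ zQuantile (α / k / 2) :=
    zQuantile_anti hβ0 (by linarith) (by linarith)
  set z := zQuantile (α / k / 2) with hz
  have hz0 : 0 < z := hzα.trans_le hzz
  have hα2 : 0 < 1 / 2 - α := by linarith
  have hfac : 0 < 12 * z / ((1 / 2 - α) * zQuantile α) := by positivity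
  have hlow := fun {i : Fin k} {f g : V} => h.ofReal_le_optimalLength (T := T) hconv hinter hα hα'
    hzz (i := i) (j := j) (f := f) (g := g)
  generalize optimalLength P T α (F j) (⋃ i, F i) = L at hlow
  rcases eq_or_ne L ∞ with rfl | hL
  · rw [ENNReal.mul_top (by simpa using hfac)]
    exact le_top
  · lift L to ℝ≥0 using hL
    set M : ℝ := z / ((1 / 2 - α) * zQuantile α) * L with hM
    have hdiff : ∀ i, ∀ f ∈ F j, ∀ g ∈ F i, ‖ι (g - f)‖ ≤ z → |T g - T f| ≤ M := by
      intro i f hf g hg hfg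
      have h1 := hlow hf hg hfg
      rw [← ENNReal.ofReal_coe_nnreal, ENNReal.ofReal_le_ofReal_iff L.coe_nonneg] at h1
      rw [hM, div_mul_eq_mul_div, le_div_iff₀ (by positivity)]
      calc |T g - T f| * ((1 / 2 - α) * zQuantile α)
          = z * ((1 / 2 - α) * (zQuantile α / z * |T g - T f|)) := by field_simp
        _ ≤ z * L := by gcongr
    have h8 := h.maxExpectedLength_bonferroniInterval_le hn hk hinter hα hα' hS j (M := M)
      (fun i => (h.orderedModulus_le_iff hn).2 fun g hg f hf hfg => by
        rw [← neg_sub g f, map_neg, norm_neg] at hfg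
        rw [← neg_sub (T g)]
        exact (neg_le_abs _).trans (hdiff i f hf g hg hfg))
      (fun i => (h.orderedModulus_le_iff hn).2 fun f hf g hg hfg =>
        (le_abs_self _).trans (hdiff i f hf g hg hfg))
    refine h8.trans ?_
    rw [← ENNReal.ofReal_coe_nnreal, ← ENNReal.ofReal_mul hfac.le]
    refine ENNReal.ofReal_le_ofReal ?_
    have hM0 : 0 ≤ M := by positivity
    calc 8 * M ≤ 12 * M := by linarith
      _ = _ := by
        rw [hM]
        ring

end IsShiftRepresentation

/-! ### The two models as Gaussian shift experiments -/

section Representation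

variable {Ω : Type*} [MeasurableSpace Ω] {μ : Measure Ω}

/-- A finite linear combination of a centered Gaussian process with covariance `⟪e s, e t⟫`. -/
lemma hasLaw_linearCombination_of_isGaussianProcess [IsProbabilityMeasure μ]
    {I H : Type*} [NormedAddCommGroup H] [InnerProductSpace ℝ H] {Z : I → Ω → ℝ} {e : I → H}
    (hZ : IsGaussianProcess Z μ)
    (h0 : ∀ t, ∫ ω, Z t ω ∂μ = 0) (hcov : ∀ s t, cov[Z s, Z t; μ] = inner ℝ (e s) (e t))
    (a : I →₀ ℝ) :
    HasLaw (fun ω => Finsupp.linearCombination ℝ (fun t => Z t ω) a)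
      (gaussianReal 0 (‖Finsupp.linearCombination ℝ e a‖₊ ^ 2)) μ := by
  have hg : HasGaussianLaw (fun ω => ∑ t ∈ a.support, a t * Z t ω) μ :=
    (hZ.smul fun t => a t).hasGaussianLaw_fun_sum (I := a.support)
  have hsum : (fun ω => Finsupp.linearCombination ℝ (fun t => Z t ω) a) =
      fun ω => ∑ t ∈ a.support, a t * Z t ω := by
    ext ω
    simp [Finsupp.linearCombination_apply, Finsupp.sum]
  have hmean : ∫ ω, ∑ t ∈ a.support, a t * Z t ω ∂μ = 0 := by
    rw [integral_finsetSum _ fun t _ => (hZ.hasGaussianLaw_eval t).integrable.const_mul _]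
    simp [integral_const_mul, h0]
  have hvar : Var[fun ω => ∑ t ∈ a.support, a t * Z t ω; μ] =
      ‖Finsupp.linearCombination ℝ e a‖ ^ 2 := by
    rw [variance_fun_sum' (X := fun t ω => a t * Z t ω)
      fun t _ => (hZ.hasGaussianLaw_eval t).memLp_two.const_mul _,
      ← real_inner_self_eq_norm_sq, Finsupp.linearCombination_apply, Finsupp.sum, sum_inner]
    refine Finset.sum_congr rfl fun s _ => ?_
    rw [inner_sum]
    refine Finset.sum_congr rfl fun t _ => ?_
    rw [covariance_const_mul_left, covariance_const_mul_right, hcov, inner_smul_left,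
      inner_smul_right]
    simp
  rw [hsum]
  refine ⟨hg.aemeasurable, ?_⟩
  rw [hg.map_eq_gaussianReal, hmean, hvar]
  congr 1
  refine NNReal.eq ?_
  rw [Real.coe_toNNReal _ (by positivity)]
  simp

/-- A model whose noise has covariance `⟪e s, e t⟫` and whose signal is `⟪e t, f⟫` is a Gaussian
shift experiment, after rescaling by the noise level `n^{-1/2}`. -/
lemma isShiftRepresentation_of_isGaussianProcess [IsProbabilityMeasure μ] {𝓜 : GaussianModel}
    {V : Submodule ℝ (𝓜.Index → ℝ)} {H : Type*} [NormedAddCommGroup H] [InnerProductSpace ℝ H]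
    [CompleteSpace H] {P : V → Measure (𝓜.Index → ℝ)} {n : ℝ} (hn : 0 < n)
    {Z : 𝓜.Index → Ω → ℝ} {e : 𝓜.Index → H} {ι : V →ₗ[ℝ] H} (hP : ∀ f : V, P f = 𝓜.law μ Z n f)
    (hZm : ∀ t, Measurable (Z t)) (hZ : IsGaussianProcess Z μ) (h0 : ∀ t, ∫ ω, Z t ω ∂μ = 0)
    (hcov : ∀ s t, cov[Z s, Z t; μ] = inner ℝ (e s) (e t))
    (hsep : ∀ x, (∀ t, inner ℝ (e t) x = 0) → x = 0)
    (hsig : ∀ (f : V) t, 𝓜.signal f t = inner ℝ (e t) (ι f))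
    (hnorm : ∀ f : V, ‖ι f‖ = 𝓜.l2Norm f) :
    IsShiftRepresentation 𝓜 P n (fun t => (√n)⁻¹ • e t) (√n • ι) := by
  have hn' : 0 < √n := Real.sqrt_pos.2 hn
  have hlc : ∀ a : 𝓜.Index →₀ ℝ, Finsupp.linearCombination ℝ (fun t => (√n)⁻¹ • e t) a =
      (√n)⁻¹ • Finsupp.linearCombination ℝ e a := fun a => by
    simp only [Finsupp.linearCombination_apply, Finsupp.sum, Finset.smul_sum]
    exact Finset.sum_congr rfl fun t _ => smul_comm _ _ _
  refine ⟨fun f a => ?_, ?_, fun f => ?_⟩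
  · have hmeas : Measurable fun ω t => 𝓜.signal f t + (√n)⁻¹ * Z t ω :=
      measurable_pi_lambda _ fun t => ((hZm t).const_mul _).const_add _
    refine ⟨(measurable_linearCombination_apply a).aemeasurable, ?_⟩
    rw [hP, GaussianModel.law, Measure.map_map (measurable_linearCombination_apply a) hmeas]
    have h1 : (fun y : 𝓜.Index → ℝ => Finsupp.linearCombination ℝ y a) ∘
        (fun ω t => 𝓜.signal f t + (√n)⁻¹ * Z t ω) = fun ω =>
        inner ℝ (Finsupp.linearCombination ℝ e a) (ι f) +
          (√n)⁻¹ * Finsupp.linearCombination ℝ (fun t => Z t ω) a := by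
      ext ω
      simp only [Function.comp_apply, Finsupp.linearCombination_apply, Finsupp.sum, sum_inner,
        Finset.mul_sum, hsig, ← Finset.sum_add_distrib]
      refine Finset.sum_congr rfl fun t _ => ?_
      rw [inner_smul_left]
      simp only [smul_eq_mul, conj_trivial]
      ring
    have h2 := gaussianReal_const_add (gaussianReal_const_mul
      (hasLaw_linearCombination_of_isGaussianProcess hZ h0 hcov a) (√n)⁻¹)
      (inner ℝ (Finsupp.linearCombination ℝ e a) (ι f))
    rw [h1, h2.map_eq, hlc]
    congr 1
    · rw [LinearMap.smul_apply, inner_smul_left, inner_smul_right, conj_trivial,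
        inv_mul_cancel_left₀ hn'.ne', mul_zero, zero_add]
    · refine NNReal.eq ?_
      push_cast
      rw [norm_smul, mul_pow, Real.norm_eq_abs, sq_abs]
  · rw [Submodule.dense_iff_topologicalClosure_eq_top, Submodule.topologicalClosure_eq_top_iff,
      Submodule.eq_bot_iff]
    intro x hx
    refine hsep x fun t => ?_
    have h1 := (Submodule.mem_orthogonal _ _).1 hx _ (Submodule.subset_span ⟨t, rfl⟩)
    simp only [inner_smul_left, conj_trivial] at h1
    exact (mul_eq_zero.1 h1).resolve_left (inv_pos.2 hn').ne'
  · rw [LinearMap.smul_apply, norm_smul, Real.norm_of_nonneg hn'.le, hnorm]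

lemma measurableEmbedding_coe_timeInterval :
    MeasurableEmbedding (Subtype.val : TimeInterval → ℝ) :=
  MeasurableEmbedding.subtype_coe measurableSet_Icc

lemma lebesgue_Iic (t : TimeInterval) :
    lebesgue (Set.Iic t) = ENNReal.ofReal ((t : ℝ) + 1 / 2) := by
  rw [lebesgue, measurableEmbedding_coe_timeInterval.comap_apply]
  have h : Subtype.val '' Set.Iic t = Set.Icc (-(1 / 2) : ℝ) t := by
    ext x
    constructor
    · rintro ⟨y, hy, rfl⟩
      exact ⟨y.2.1, hy⟩
    · rintro ⟨h1, h2⟩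
      exact ⟨⟨x, h1, h2.trans t.2.2⟩, h2, rfl⟩
  rw [h, Real.volume_Icc]
  congr 1
  ring

instance isFiniteMeasure_lebesgue : IsFiniteMeasure lebesgue := by
  refine ⟨?_⟩
  rw [lebesgue, measurableEmbedding_coe_timeInterval.comap_apply, Set.image_univ,
    Subtype.range_coe_subtype]
  exact (measure_mono fun x hx => hx).trans_lt (measure_Icc_lt_top (a := -(1 / 2 : ℝ)) (b := 1 / 2))

/-- An integrable function all of whose integrals over the intervals `[-1/2, t]` vanish is zero. -/
lemma ae_eq_zero_of_setIntegral_Iic_eq_zero {g : TimeInterval → ℝ} (hg : Integrable g lebesgue)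
    (h : ∀ t, ∫ s in Set.Iic t, g s ∂lebesgue = 0) : g =ᵐ[lebesgue] 0 := by
  have htop : ∫ s, g s ∂lebesgue = 0 := by
    have h1 := h ⟨1 / 2, by norm_num, le_rfl⟩
    have h2 : Set.Iic (⟨1 / 2, by norm_num, le_rfl⟩ : TimeInterval) = Set.univ :=
      Set.eq_univ_of_forall fun s => s.2.2
    rwa [h2, setIntegral_univ] at h1
  refine hg.ae_eq_zero_of_forall_setIntegral_eq_zero fun s hs hfin => ?_
  clear hfin
  induction s, hs using MeasurableSpace.induction_on_inter
    ((borel_eq_generateFrom_Iic TimeInterval).symm ▸ BorelSpace.measurable_eq) isPiSystem_Iic with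
  | empty => simp
  | basic s hs =>
    obtain ⟨t, rfl⟩ := hs
    exact h t
  | compl s hs ih => rw [setIntegral_compl hs hg, ih, htop, sub_zero]
  | iUnion f hd hm ih =>
    rw [integral_iUnion hm hd hg.integrableOn]
    simp [ih]

/-- The indicator function of `[-1/2, t]` in `L²(-1/2, 1/2)`: the observation `Y t` is the Wiener
integral of this function. -/
noncomputable def indicatorIic (t : TimeInterval) : Lp ℝ 2 lebesgue :=
  indicatorConstLp 2 (measurableSet_Iic (a := t)) (measure_ne_top lebesgue _) 1

lemma inner_indicatorIic (t : TimeInterval) (x : Lp ℝ 2 lebesgue) :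
    inner ℝ (indicatorIic t) x = ∫ s in Set.Iic t, x s ∂lebesgue :=
  L2.inner_indicatorConstLp_one _ _ x

lemma eq_zero_of_inner_indicatorIic {x : Lp ℝ 2 lebesgue}
    (hx : ∀ t, inner ℝ (indicatorIic t) x = 0) : x = 0 := by
  refine Lp.eq_zero_iff_ae_eq_zero.2 (ae_eq_zero_of_setIntegral_Iic_eq_zero
    ((Lp.memLp x).integrable (by norm_num)) fun t => ?_)
  rw [← hx t, inner_indicatorIic]

lemma covariance_eq_inner_indicatorIic {W : ℝ≥0 → Ω → ℝ} (hW : IsBrownianReal W μ)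
    (s t : TimeInterval) :
    cov[W (Real.toNNReal ((s : ℝ) + 1 / 2)), W (Real.toNNReal ((t : ℝ) + 1 / 2)); μ] =
      inner ℝ (indicatorIic s) (indicatorIic t) := by
  rw [hW.covariance_eval, indicatorIic, indicatorIic, L2.inner_indicatorConstLp_indicatorConstLp,
    Set.Iic_inter_Iic, measureReal_def, lebesgue_Iic]
  simp only [real_inner_self_eq_norm_sq, norm_one, one_pow, smul_eq_mul, mul_one]
  rcases le_total s t with h | h
  · rw [min_eq_left h, min_eq_left (Real.toNNReal_le_toNNReal (by gcongr))]
    rfl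
  · rw [min_eq_right h, min_eq_right (Real.toNNReal_le_toNNReal (by gcongr))]
    rfl

lemma exists_linearMap_Lp {V : Submodule ℝ (TimeInterval → ℝ)}
    (hV : ∀ f ∈ V, MemLp f 2 lebesgue) :
    ∃ ι : V →ₗ[ℝ] Lp ℝ 2 lebesgue,
      (∀ (f : V) t, ∫ s in Set.Iic t, f.1 s ∂lebesgue = inner ℝ (indicatorIic t) (ι f)) ∧
      ∀ f : V, ‖ι f‖ = √(∫ t, f.1 t ^ 2 ∂lebesgue) := by
  let ι : V →ₗ[ℝ] Lp ℝ 2 lebesgue :=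
    { toFun := fun f => (hV f f.2).toLp _
      map_add' := fun f g => (hV f f.2).toLp_add (hV g g.2)
      map_smul' := fun c f => (hV f f.2).toLp_const_smul c }
  have hae : ∀ f : V, ι f =ᵐ[lebesgue] f.1 := fun f => (hV f f.2).coeFn_toLp
  refine ⟨ι, fun f t => ?_, fun f => ?_⟩
  · rw [inner_indicatorIic]
    exact (integral_congr_ae (ae_restrict_of_ae (hae f))).symm
  · rw [← Real.sqrt_sq (norm_nonneg (ι f)), ← real_inner_self_eq_norm_sq, L2.inner_def]
    congr 1
    refine integral_congr_ae ?_
    filter_upwards [hae f] with t ht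
    rw [ht, real_inner_self_eq_norm_sq, Real.norm_eq_abs, sq_abs]

lemma exists_linearMap_lp {M : Type} {V : Submodule ℝ (M → ℝ)}
    (hV : ∀ f ∈ V, Summable fun i => f i ^ 2) :
    ∃ ι : V →ₗ[ℝ] lp (fun _ : M => ℝ) 2, (∀ (f : V) i, ι f i = f.1 i) ∧
      ∀ f : V, ‖ι f‖ = √(∑' i, f.1 i ^ 2) := by
  have hV' : ∀ f : V, Memℓp f.1 2 := fun f => by
    rw [memℓp_gen_iff (by norm_num)]
    simpa using hV f f.2
  let ι : V →ₗ[ℝ] lp (fun _ : M => ℝ) 2 :=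
    { toFun := fun f => ⟨f.1, hV' f⟩
      map_add' := fun f g => rfl
      map_smul' := fun c f => rfl }
  refine ⟨ι, fun f i => rfl, fun f => ?_⟩
  rw [← Real.sqrt_sq (norm_nonneg (ι f)), ← real_inner_self_eq_norm_sq, lp.inner_eq_tsum]
  congr 1
  refine tsum_congr fun i => ?_
  rw [real_inner_self_eq_norm_sq, Real.norm_eq_abs, sq_abs]
  rfl

lemma isGaussianProcess_of_iIndepFun {M : Type} {Z : M → Ω → ℝ} (hind : iIndepFun Z μ)
    (hlaw : ∀ i, HasLaw (Z i) (gaussianReal 0 1) μ) : IsGaussianProcess Z μ :=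
  ⟨fun J => iIndepFun.hasGaussianLaw (X := fun i : J => Z i) (fun i => (hlaw i).hasGaussianLaw)
    (hind.precomp Subtype.val_injective)⟩

lemma covariance_eq_inner_single {M : Type} [DecidableEq M] {Z : M → Ω → ℝ}
    (hind : iIndepFun Z μ) (hlaw : ∀ i, HasLaw (Z i) (gaussianReal 0 1) μ) (i j : M) :
    cov[Z i, Z j; μ] = inner ℝ (lp.single (E := fun _ : M => ℝ) 2 i (1 : ℝ))
      (lp.single (E := fun _ : M => ℝ) 2 j (1 : ℝ)) := by
  rw [lp.inner_single_left]
  rcases eq_or_ne i j with rfl | hij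
  · rw [covariance_self (hlaw i).aemeasurable, (hlaw i).variance_eq, variance_id_gaussianReal]
    simp
  · rw [(hind.indepFun hij).covariance_eq_zero (hlaw i).hasGaussianLaw.memLp_two
      (hlaw j).hasGaussianLaw.memLp_two]
    simp [hij]

/-- Both models are Gaussian shift experiments: over `L²(-1/2, 1/2)` with the indicators of
`[-1/2, t]` for white noise, over `ℓ²(M)` with the standard basis for sequences. -/
theorem exists_isShiftRepresentation [IsProbabilityMeasure μ] {𝓜 : GaussianModel}
    {Z : 𝓜.Index → Ω → ℝ} (hZ : 𝓜.IsNoise μ Z) {n : ℝ} (hn : 0 < n) {V : Submodule ℝ (𝓜.Index → ℝ)}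
    (hV : ∀ f ∈ V, 𝓜.SquareIntegrable f) {P : V → Measure (𝓜.Index → ℝ)}
    (hP : ∀ f : V, P f = 𝓜.law μ Z n f) :
    ∃ (H : Type) (_ : NormedAddCommGroup H) (_ : InnerProductSpace ℝ H) (_ : CompleteSpace H)
      (e : 𝓜.Index → H) (ι : V →ₗ[ℝ] H), IsShiftRepresentation 𝓜 P n e ι := by
  cases 𝓜 with
  | whiteNoise =>
    obtain ⟨hZm, W, hW, hZW⟩ := hZ
    obtain rfl : Z = fun (t : TimeInterval) => W (Real.toNNReal ((t : ℝ) + 1 / 2)) := funext hZW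
    obtain ⟨ι, hsig, hnorm⟩ := exists_linearMap_Lp hV
    exact ⟨Lp ℝ 2 lebesgue, inferInstance, inferInstance, inferInstance, _, _,
      isShiftRepresentation_of_isGaussianProcess (e := indicatorIic) hn hP hZm
        (hW.isGaussianProcess.comp_right fun t : TimeInterval => Real.toNNReal ((t : ℝ) + 1 / 2))
        (fun t => hW.integral_eval _) (fun s t => covariance_eq_inner_indicatorIic hW s t)
        (fun x hx => eq_zero_of_inner_indicatorIic hx) hsig hnorm⟩
  | sequence M hM =>
    classical
    obtain ⟨hZm, hind, hlaw⟩ := hZ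
    obtain ⟨ι, hsig, hnorm⟩ := exists_linearMap_lp hV
    refine ⟨lp (fun _ : M => ℝ) 2, inferInstance, inferInstance, inferInstance, _, _,
      isShiftRepresentation_of_isGaussianProcess
        (e := fun i : M => lp.single (E := fun _ : M => ℝ) 2 i (1 : ℝ)) hn hP hZm
        (isGaussianProcess_of_iIndepFun hind hlaw)
        (fun i => (hlaw i).integral_eq.trans integral_id_gaussianReal)
        (fun i j => covariance_eq_inner_single hind hlaw i j) (fun x hx => ?_)
        (fun f i => ?_) hnorm⟩
    · refine lp.ext (funext fun i : M => ?_)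
      have h1 := hx i
      rw [lp.inner_single_left] at h1
      simpa using h1
    · refine Eq.trans ?_ (lp.inner_single_left (𝕜 := ℝ) (G := fun _ : M => ℝ) i 1 (ι f)).symm
      rw [hsig]
      simp [GaussianModel.signal]

end Representation

/-! ### The adaptive confidence interval -/

theorem theorem3 {Ω : Type*} [MeasurableSpace Ω] (μ : Measure Ω) [IsProbabilityMeasure μ]
    (𝓜 : GaussianModel) (Z : 𝓜.Index → Ω → ℝ) (hZ : 𝓜.IsNoise μ Z)
    (n : ℝ) (hn : 0 < n)
    (V : Submodule ℝ (𝓜.Index → ℝ)) (hV : ∀ f ∈ V, 𝓜.SquareIntegrable f)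
    (T : V →ₗ[ℝ] ℝ)
    (k : ℕ) (hk : 1 ≤ k) (F : Fin k → Set V)
    (hconv : ∀ j, Convex ℝ (F j)) (hinter : ∀ i j, (F i ∩ F j).Nonempty)
    (α : ℝ) (hα : 0 < α) (hα' : α < 1 / 2)
    (P : V → Measure (𝓜.Index → ℝ)) (hP : ∀ f : V, P f = 𝓜.law μ Z n f) :
    (∃ S, 𝓜.IsEstimatorFamily P n T F (α / k) S) ∧
    (∀ S, 𝓜.IsEstimatorFamily P n T F (α / k) S →
      𝓜.bonferroniInterval n T F α S ∈ confidenceIntervals P T α (⋃ j, F j) ∧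
      ∀ j, optimalLength P T α (F j) (⋃ i, F i) ≤
          maxExpectedLength P (𝓜.bonferroniInterval n T F α S) (F j) ∧
        maxExpectedLength P (𝓜.bonferroniInterval n T F α S) (F j) ≤
          ENNReal.ofReal (12 * zQuantile (α / (2 * k)) / ((1 / 2 - α) * zQuantile α)) *
            optimalLength P T α (F j) (⋃ i, F i)) ∧
    zQuantile (α / (2 * k)) ≤
      √(2 / zQuantile (α / 2) ^ 2 * Real.log k + 1) * zQuantile (α / 2) := by
  obtain ⟨H, _, _, _, e, ι, h⟩ := exists_isShiftRepresentation hZ hn hV hP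
  have hk0 : (1 : ℝ) ≤ k := by exact_mod_cast hk
  have hβ0 : 0 < α / k / 2 := by positivity
  have hβα : α / k ≤ α := div_le_self hα.le hk0
  have hlevel : α / (2 * k) = α / k / 2 := by
    rw [div_div, mul_comm]
  refine ⟨?_, fun S hS => ?_, ?_⟩
  · exact h.exists_isEstimatorFamily hn T hconv hinter (zQuantile_pos hβ0 (by linarith))
  · have hmem := h.bonferroniInterval_mem_confidenceIntervals hn hk hinter hα hα' hS
    refine ⟨hmem, fun j => ⟨iInf₂_le _ hmem, ?_⟩⟩
    rw [hlevel]
    exact h.maxExpectedLength_le_mul_optimalLength hn hk hconv hinter hα hα' hS j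
  · rw [← div_div]
    exact zQuantile_div_le (by positivity) (by linarith) hk0
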